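/- Conventions. A hyperfield is a system $(H,+,\cdot,-,0,1)$ with a commutative, associative multivalued addition $+:H\times H\to\mathcal P(H)$ satisfying $c\in a+b\Rightarrow a\in c+(-b)$ and $a\in b+0\iff a=b$; a commutative monoid structure $(H,\cdot,1)$ with $a0=0$ and $a(b+c)\subseteq ab+ac$; $1\neq 0$; and inverses of all non-zero elements. A morphism is a map $\alpha$ with $\alpha(a+b)\subseteq\alpha(a)+\alpha(b)$ that respects $\cdot,-,0,1$; an isomorphism is an invertible morphism whose inverse is a morphism. For a field $K$ and a subgroup $T\subseteq K^*$, the quotient hyperfield $K/_mT$ is the set of classes of $K$ under $a\sim b\iff as=bt$ for some $s,t\in T$, with the induced operations, where $\overline c\in\overline a+\overline b$ iff $cs=at+bu$ for some $s,t,u\in T$. The prime of a hyperfield $H$ is $H$ with the new addition $a+'b=a+b$ if $a=0$ or $b=0$; $a+'b=(a+b)\cup\{a,b\}$ if $a,b\ne0$, $b\neq-a$; $a+'b=H$ if $a\neq 0$ and $b=-a$. The quadratic hyperfield $Q(K)$ is the prime of $K/_mK^{*2}$; its group of non-zero elements is $K^*/K^{*2}$. For a valuation $v$ on a field $K$ let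 $\Gamma_v$, $M_v$, $U_v$ denote the value group, the maximal ideal and the unit group of the valuation ring. For a subgroup $T\subseteq K^*$, an element $x\in K^*$ is $T$-rigid if $T+Tx\subseteq T\cup Tx$; the basic part of $T$ is $B(T)=\{x\in K^*: x \text{ or } -x \text{ is not } T\text{-rigid}\}$; $T$ is exceptional if $B(T)=T\cup -T$ and either $-1\in T$ or $T+T\subseteq T$, and unexceptional otherwise. Theorem. Let $K,L$ be fields, $\alpha:Q(K)\to Q(L)$ a hyperfield isomorphism, and $v$ a valuation on $K$ such that $\Gamma_v$ is finitely generated as an abelian group. Suppose either (i) the basic part of $(1+M_v)K^{*2}$ is $U_vK^{*2}$, and $(1+M_v)K^{*2}$ is unexceptional, or (ii) the basic part of $(1+M_v)K^{*2}$ is $(1+M_v)K^{*2}$, and $(1+M_v)K^{*2}$ has index $2$ in $U_vK^{*2}$. Then there exists a valuation $w$ on $L$ such that $$\alpha\bigl((1+M_v)K^{*2}/K^{*2}\bigr)=(1+M_w)L^{*2}/L^{*2}\quad\text{and}\quad (L^*:U_wL^{*2})\ge (K^*:U_vK^{*2}),$$ and such that, if (i) holds, also $\alpha\bigl(U_vK^{*2}/K^{*2}\bigr)=U_wL^{*2}/L^{*2}$.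 -/

import Mathlib

open scoped Cardinal

universe u₁ u₂ u₃

/-! ### Hyperfields -/

/-- A hyperfield: `hadd a b` is the (multivalued) sum of `a` and `b`. -/
class Hyperfield (H : Type*) extends CommMonoidWithZero H, Neg H where
  hadd : H → H → Set H
  mem_hadd_neg : ∀ a b c : H, c ∈ hadd a b → a ∈ hadd c (-b)
  mem_hadd_zero : ∀ a b : H, a ∈ hadd b 0 ↔ a = b
  hadd_assoc : ∀ a b c : H, (⋃ y ∈ hadd a b, hadd y c) = ⋃ z ∈ hadd b c, hadd a z
  hadd_comm : ∀ a b : H, hadd a b = hadd b a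
  mul_hadd : ∀ a b c : H, (fun x => a * x) '' hadd b c ⊆ hadd (a * b) (a * c)
  one_ne_zero' : (1 : H) ≠ 0
  exists_inv : ∀ a : H, a ≠ 0 → ∃ b : H, a * b = 1

namespace Hyperfield

/-- Morphisms of hyperfields. -/
structure IsMorphism {H₁ H₂ : Type*} [Hyperfield H₁] [Hyperfield H₂] (f : H₁ → H₂) : Prop where
  map_hadd : ∀ a b, f '' hadd a b ⊆ hadd (f a) (f b)
  map_mul : ∀ a b, f (a * b) = f a * f b
  map_neg : ∀ a, f (-a) = -f a
  map_zero : f 0 = 0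
  map_one : f 1 = 1

/-- An isomorphism of hyperfields: an invertible morphism whose inverse is a morphism. -/
structure Iso (H₁ H₂ : Type*) [Hyperfield H₁] [Hyperfield H₂] extends H₁ ≃ H₂ where
  isMorphism : IsMorphism toFun
  isMorphism_symm : IsMorphism invFun

section Basic

variable {H : Type*} [Hyperfield H]

theorem mem_zero_hadd (a b : H) : a ∈ hadd 0 b ↔ a = b := by
  rw [hadd_comm, mem_hadd_zero]

theorem neg_unique {a b : H} (h : 0 ∈ hadd a b) : a = -b :=
  (mem_zero_hadd _ _).1 (mem_hadd_neg _ _ _ h)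

theorem zero_mem_hadd_neg (a : H) : 0 ∈ hadd a (-a) :=
  mem_hadd_neg _ _ _ ((mem_zero_hadd a a).2 rfl)

theorem hneg_neg (a : H) : -(-a) = a := (neg_unique (zero_mem_hadd_neg a)).symm

theorem hneg_zero : -(0 : H) = 0 := ((mem_zero_hadd _ _).1 (zero_mem_hadd_neg (0 : H))).symm

theorem hneg_ne_zero {a : H} (h : a ≠ 0) : -a ≠ 0 := fun h' => h (by
  rw [← hneg_neg a, h', hneg_zero])

theorem hmul_neg (a b : H) : a * -b = -(a * b) := by
  have h := mul_hadd a b (-b) ⟨0, zero_mem_hadd_neg b, rfl⟩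
  simp only [mul_zero] at h
  rw [hadd_comm] at h
  exact neg_unique h

theorem hmul_ne_zero {a b : H} (ha : a ≠ 0) (hb : b ≠ 0) : a * b ≠ 0 := by
  obtain ⟨c, hc⟩ := exists_inv a ha
  intro h
  apply hb
  calc b = (a * c) * b := by rw [hc, one_mul]
    _ = c * (a * b) := by rw [mul_comm a c, mul_assoc]
    _ = 0 := by rw [h, mul_zero]

end Basic

/-! ### The prime of a hyperfield -/

open Classical in
/-- The prime addition on a hyperfield. -/
def primeAdd {H : Type*} [Hyperfield H] (a b : H) : Set H :=
  if a = 0 ∨ b = 0 then hadd a b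
  else if b = -a then Set.univ
  else hadd a b ∪ {a, b}

theorem mem_primeAdd {H : Type*} [Hyperfield H] (a b x : H) :
    x ∈ primeAdd a b ↔ x ∈ hadd a b ∨ (a ≠ 0 ∧ b ≠ 0 ∧ (x = a ∨ x = b ∨ b = -a)) := by
  unfold primeAdd
  split_ifs with h1 h2
  · tauto
  · have ha : a ≠ 0 := fun h => h1 (.inl h)
    have hb : b ≠ 0 := fun h => h1 (.inr h)
    simp only [Set.mem_univ, true_iff]
    exact .inr ⟨ha, hb, .inr (.inr h2)⟩
  · simp; tauto

/-- The prime `H'` of the hyperfield `H`: same underlying set, multiplication and negation,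
with the prime addition. -/
def Prime (H : Type*) : Type _ := H

theorem primeAdd_comm {H : Type*} [Hyperfield H] (a b : H) : primeAdd a b = primeAdd b a := by
  ext x
  rw [mem_primeAdd, mem_primeAdd, hadd_comm]
  have : b = -a ↔ a = -b :=
    ⟨fun h => by rw [h, hneg_neg], fun h => by rw [h, hneg_neg]⟩
  tauto

theorem primeAdd_neg {H : Type*} [Hyperfield H] (a b c : H) (h : c ∈ primeAdd a b) :
    a ∈ primeAdd c (-b) := by
  rw [mem_primeAdd] at h ⊢
  rcases h with h | ⟨ha, hb, h⟩
  · exact .inl (mem_hadd_neg _ _ _ h)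
  · by_cases hc : c = 0
    · subst hc
      rcases h with h | h | h
      · exact absurd h.symm ha
      · exact absurd h.symm hb
      · left; rw [mem_zero_hadd, h, hneg_neg]
    · refine .inr ⟨hc, hneg_ne_zero hb, ?_⟩
      rcases h with h | h | h
      · exact .inl h.symm
      · exact .inr (.inr (by rw [h]))
      · exact .inr (.inl (by rw [h, hneg_neg]))

theorem primeAdd_zero {H : Type*} [Hyperfield H] (a b : H) : a ∈ primeAdd b 0 ↔ a = b := by
  rw [mem_primeAdd, mem_hadd_zero]; tauto

theorem primeAdd_assoc_aux {H : Type*} [Hyperfield H] (a b c x y : H) (hy : y ∈ primeAdd a b)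
    (hx : x ∈ primeAdd y c) : ∃ z ∈ primeAdd b c, x ∈ primeAdd a z := by
  by_cases ha : a = 0
  · subst ha
    rw [primeAdd_comm, primeAdd_zero] at hy
    subst hy
    exact ⟨x, hx, by rw [primeAdd_comm, primeAdd_zero]⟩
  by_cases hb : b = 0
  · subst hb
    rw [primeAdd_zero] at hy
    subst hy
    exact ⟨c, by rw [primeAdd_comm, primeAdd_zero], hx⟩
  by_cases hc : c = 0
  · subst hc
    rw [primeAdd_zero] at hx
    subst hx
    exact ⟨b, by rw [primeAdd_zero], hy⟩
  by_cases hx0 : x = 0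
  · subst hx0
    have h1 : y = -c := by
      rw [mem_primeAdd] at hx
      rcases hx with h | ⟨h0, _, h | h | h⟩
      · exact neg_unique h
      · exact absurd h.symm h0
      · exact absurd h.symm hc
      · rw [h, hneg_neg]
    subst h1
    refine ⟨-a, ?_, by rw [mem_primeAdd]; exact .inl (zero_mem_hadd_neg a)⟩
    rw [primeAdd_comm] at hy
    have h2 := primeAdd_neg _ _ _ hy
    rw [primeAdd_comm] at h2
    have h3 := primeAdd_neg _ _ _ h2
    rwa [hneg_neg] at h3
  rw [mem_primeAdd] at hx hy
  rcases hy with hy | ⟨-, -, hy⟩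
  · rcases hx with hx | ⟨hy0, -, hx⟩
    · have h : x ∈ ⋃ y ∈ hadd a b, hadd y c := by
        simp only [Set.mem_iUnion]; exact ⟨y, hy, hx⟩
      rw [hadd_assoc] at h
      simp only [Set.mem_iUnion] at h
      obtain ⟨z, hz, hxz⟩ := h
      exact ⟨z, (mem_primeAdd _ _ _).2 (.inl hz), (mem_primeAdd _ _ _).2 (.inl hxz)⟩
    · rcases hx with hx | hx | hx
      · subst hx
        exact ⟨b, (mem_primeAdd _ _ _).2 (.inr ⟨hb, hc, .inl rfl⟩),
          (mem_primeAdd _ _ _).2 (.inl hy)⟩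
      · subst hx
        exact ⟨x, (mem_primeAdd _ _ _).2 (.inr ⟨hb, hc, .inr (.inl rfl)⟩),
          (mem_primeAdd _ _ _).2 (.inr ⟨ha, hc, .inr (.inl rfl)⟩)⟩
      · subst hx
        refine ⟨-a, (mem_primeAdd _ _ _).2 (.inl ?_), (mem_primeAdd _ _ _).2
          (.inr ⟨ha, hneg_ne_zero ha, .inr (.inr rfl)⟩)⟩
        have h10 : b ∈ hadd y (-a) := by
          rw [hadd_comm] at hy; exact mem_hadd_neg _ _ _ hy
        rw [hadd_comm] at h10
        exact mem_hadd_neg _ _ _ h10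
  · rcases hy with hy | hy | hy
    · subst hy
      exact ⟨c, (mem_primeAdd _ _ _).2 (.inr ⟨hb, hc, .inr (.inl rfl)⟩), (mem_primeAdd _ _ _).2 hx⟩
    · subst hy
      exact ⟨x, (mem_primeAdd _ _ _).2 hx,
        (mem_primeAdd _ _ _).2 (.inr ⟨ha, hx0, .inr (.inl rfl)⟩)⟩
    · subst hy
      rcases hx with hx | ⟨hy0, -, hx⟩
      all_goals
        refine ⟨-a, (mem_primeAdd _ _ _).2 (.inr ⟨hb, hc, .inl rfl⟩), (mem_primeAdd _ _ _).2
          (.inr ⟨ha, hb, .inr (.inr rfl)⟩)⟩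

theorem primeAdd_assoc {H : Type*} [Hyperfield H] (a b c : H) :
    (⋃ y ∈ primeAdd a b, primeAdd y c) = ⋃ z ∈ primeAdd b c, primeAdd a z := by
  ext x
  simp only [Set.mem_iUnion, exists_prop]
  constructor
  · rintro ⟨y, hy, hx⟩
    exact primeAdd_assoc_aux a b c x y hy hx
  · rintro ⟨z, hz, hx⟩
    obtain ⟨y, hy, hxy⟩ := primeAdd_assoc_aux c b a x z
      (by rw [primeAdd_comm]; exact hz) (by rw [primeAdd_comm]; exact hx)
    exact ⟨y, by rw [primeAdd_comm]; exact hy, by rw [primeAdd_comm]; exact hxy⟩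

theorem mul_primeAdd {H : Type*} [Hyperfield H] (a b c : H) :
    (fun x => a * x) '' primeAdd b c ⊆ primeAdd (a * b) (a * c) := by
  rintro _ ⟨x, hx, rfl⟩
  rw [mem_primeAdd] at hx ⊢
  by_cases ha : a = 0
  · subst ha; left; simp [mem_hadd_zero]
  rcases hx with hx | ⟨hb, hc, hx⟩
  · exact .inl (mul_hadd a b c ⟨x, hx, rfl⟩)
  · refine .inr ⟨hmul_ne_zero ha hb, hmul_ne_zero ha hc, ?_⟩
    rcases hx with hx | hx | hx
    · exact .inl (by rw [hx])
    · exact .inr (.inl (by rw [hx]))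
    · exact .inr (.inr (by rw [hx, hmul_neg]))

instance {H : Type*} [Hyperfield H] : Hyperfield (Prime H) where
  __ := (inferInstance : CommMonoidWithZero H)
  neg := (Neg.neg : H → H)
  hadd := (primeAdd : H → H → Set H)
  mem_hadd_neg := primeAdd_neg (H := H)
  mem_hadd_zero := primeAdd_zero (H := H)
  hadd_assoc := primeAdd_assoc (H := H)
  hadd_comm := primeAdd_comm (H := H)
  mul_hadd := mul_primeAdd (H := H)
  one_ne_zero' := one_ne_zero' (H := H)
  exists_inv := exists_inv (H := H)

end Hyperfield

/-! ### Quotient hyperfields of a field -/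

section Quotient

variable {K : Type*} [Field K]

/-- `a ∼ b` iff `a * s = b * t` for some `s, t ∈ T`. -/
def quotientSetoid (T : Subgroup Kˣ) : Setoid K where
  r a b := ∃ s ∈ T, ∃ t ∈ T, a * (s : Kˣ) = b * (t : Kˣ)
  iseqv := by
    refine ⟨fun a => ⟨1, T.one_mem, 1, T.one_mem, rfl⟩, ?_, ?_⟩
    · rintro a b ⟨s, hs, t, ht, h⟩
      exact ⟨t, ht, s, hs, h.symm⟩
    · rintro a b c ⟨s, hs, t, ht, h⟩ ⟨s', hs', t', ht', h'⟩
      refine ⟨s * s', T.mul_mem hs hs', t * t', T.mul_mem ht ht', ?_⟩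
      push_cast
      linear_combination (s' : K) * h + (t : K) * h'

/-- The quotient `K /ₘ T` of the field `K` modulo the multiplicative subgroup `T` of `Kˣ`. -/
def QuotientHyperfield (K : Type*) [Field K] (T : Subgroup Kˣ) : Type _ :=
  Quotient (quotientSetoid T)

namespace QuotientHyperfield

/-- The class of `a` in `K /ₘ T`. -/
def mk (T : Subgroup Kˣ) (a : K) : QuotientHyperfield K T := Quotient.mk (quotientSetoid T) a

variable {T : Subgroup Kˣ}

theorem mk_eq_mk {a b : K} :
    mk T a = mk T b ↔ ∃ s ∈ T, ∃ t ∈ T, a * (s : Kˣ) = b * (t : Kˣ) := Quotient.eq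

theorem mk_surjective (x : QuotientHyperfield K T) : ∃ a, mk T a = x := Quotient.exists_rep x

theorem mk_mul_unit (a : K) {s : Kˣ} (hs : s ∈ T) : mk T (a * s) = mk T a :=
  mk_eq_mk.2 ⟨1, T.one_mem, s, hs, by simp⟩

instance : Zero (QuotientHyperfield K T) := ⟨mk T 0⟩
instance : One (QuotientHyperfield K T) := ⟨mk T 1⟩
instance : Neg (QuotientHyperfield K T) :=
  ⟨Quotient.map Neg.neg (by
    rintro a b ⟨s, hs, t, ht, h⟩
    exact ⟨s, hs, t, ht, by linear_combination -h⟩)⟩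
instance : Mul (QuotientHyperfield K T) :=
  ⟨Quotient.map₂ (· * ·) (by
    rintro a b ⟨s, hs, t, ht, h⟩ a' b' ⟨s', hs', t', ht', h'⟩
    refine ⟨s * s', T.mul_mem hs hs', t * t', T.mul_mem ht ht', ?_⟩
    push_cast
    linear_combination (a' * s' : K) * h + (b * t : K) * h')⟩

/-- `c̄ ∈ ā + b̄` iff `c * s = a * t + b * u` for some `s, t, u ∈ T`; equivalently (as stated here),
iff `c' = a' + b'` for some representatives. -/
def add (x y : QuotientHyperfield K T) : Set (QuotientHyperfield K T) :=
  {z | ∃ a b : K, mk T a = x ∧ mk T b = y ∧ mk T (a + b) = z}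

theorem mk_mem_add (a b c : K) : mk T c ∈ add (mk T a) (mk T b) ↔
    ∃ s ∈ T, ∃ t ∈ T, ∃ u ∈ T, c * (s : Kˣ) = a * (t : Kˣ) + b * (u : Kˣ) := by
  constructor
  · rintro ⟨a', b', ha, hb, hc⟩
    obtain ⟨s, hs, t, ht, h⟩ := mk_eq_mk.1 ha
    obtain ⟨s', hs', t', ht', h'⟩ := mk_eq_mk.1 hb
    obtain ⟨p, hp, q, hq, h''⟩ := mk_eq_mk.1 hc
    refine ⟨q * s * s', T.mul_mem (T.mul_mem hq hs) hs', t * p * s',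
      T.mul_mem (T.mul_mem ht hp) hs', t' * p * s, T.mul_mem (T.mul_mem ht' hp) hs, ?_⟩
    push_cast
    linear_combination (-(s * s') : K) * h'' + (p * s' : K) * h + (p * s : K) * h'
  · rintro ⟨s, hs, t, ht, u, hu, h⟩
    exact ⟨a * t, b * u, mk_mul_unit a ht, mk_mul_unit b hu, by rw [← h, mk_mul_unit c hs]⟩

theorem mk_mul (a b : K) : mk T a * mk T b = mk T (a * b) := rfl
theorem mk_neg (a : K) : -mk T a = mk T (-a) := rfl
theorem mk_zero : mk T 0 = 0 := rfl
theorem mk_one : mk T 1 = 1 := rfl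

theorem mk_eq_zero {a : K} : mk T a = 0 ↔ a = 0 := by
  rw [← mk_zero, mk_eq_mk]
  constructor
  · rintro ⟨s, _, t, _, h⟩
    simpa using h
  · rintro rfl
    exact ⟨1, T.one_mem, 1, T.one_mem, rfl⟩

theorem add_comm' (x y : QuotientHyperfield K T) : add x y = add y x := by
  ext z
  constructor
  · rintro ⟨a, b, ha, hb, hc⟩
    exact ⟨b, a, hb, ha, by rw [add_comm, hc]⟩
  · rintro ⟨a, b, ha, hb, hc⟩
    exact ⟨b, a, hb, ha, by rw [add_comm, hc]⟩

theorem add_assoc_aux (x y z w v : QuotientHyperfield K T) (hv : v ∈ add x y) (hw : w ∈ add v z) :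
    ∃ v' ∈ add y z, w ∈ add x v' := by
  obtain ⟨a, b, rfl, rfl, rfl⟩ := hv
  obtain ⟨d, c, hd, rfl, rfl⟩ := hw
  obtain ⟨s, hs, t, ht, h⟩ := mk_eq_mk.1 hd
  refine ⟨_, ⟨b, c * ((s * t⁻¹ : Kˣ) : K), rfl, mk_mul_unit c (T.mul_mem hs (T.inv_mem ht)), rfl⟩,
    ⟨a, _, rfl, rfl, ?_⟩⟩
  refine mk_eq_mk.2 ⟨t, ht, s, hs, ?_⟩
  push_cast
  have ht0 : (t : K) ≠ 0 := t.ne_zero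
  field_simp
  linear_combination -h

instance : Hyperfield (QuotientHyperfield K T) where
  mul_assoc x y z := by
    obtain ⟨a, rfl⟩ := mk_surjective x
    obtain ⟨b, rfl⟩ := mk_surjective y
    obtain ⟨c, rfl⟩ := mk_surjective z
    simp only [mk_mul, mul_assoc]
  mul_comm x y := by
    obtain ⟨a, rfl⟩ := mk_surjective x
    obtain ⟨b, rfl⟩ := mk_surjective y
    simp only [mk_mul, mul_comm]
  one_mul x := by
    obtain ⟨a, rfl⟩ := mk_surjective x
    rw [← mk_one, mk_mul, one_mul]
  mul_one x := by
    obtain ⟨a, rfl⟩ := mk_surjective x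
    rw [← mk_one, mk_mul, mul_one]
  zero_mul x := by
    obtain ⟨a, rfl⟩ := mk_surjective x
    rw [← mk_zero, mk_mul, zero_mul]
  mul_zero x := by
    obtain ⟨a, rfl⟩ := mk_surjective x
    rw [← mk_zero, mk_mul, mul_zero]
  hadd := add
  mem_hadd_neg x y z := by
    rintro ⟨a, b, rfl, rfl, rfl⟩
    exact ⟨a + b, -b, rfl, rfl, by rw [add_neg_cancel_right]⟩
  mem_hadd_zero x y := by
    constructor
    · rintro ⟨a, b, rfl, hb, rfl⟩
      rw [mk_eq_zero.1 hb, add_zero]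
    · rintro rfl
      obtain ⟨a, rfl⟩ := mk_surjective x
      exact ⟨a, 0, rfl, rfl, by rw [add_zero]⟩
  hadd_assoc x y z := by
    ext w
    simp only [Set.mem_iUnion]
    constructor
    · rintro ⟨v, hv, hw⟩
      obtain ⟨v', h1, h2⟩ := add_assoc_aux x y z w v hv hw
      exact ⟨v', h1, h2⟩
    · rintro ⟨v, hv, hw⟩
      obtain ⟨v', h1, h2⟩ := add_assoc_aux z y x w v (by rwa [add_comm']) (by rwa [add_comm'])
      exact ⟨v', by rwa [add_comm'], by rwa [add_comm']⟩
  hadd_comm := add_comm'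
  mul_hadd x y z := by
    rintro _ ⟨w, ⟨a, b, rfl, rfl, rfl⟩, rfl⟩
    obtain ⟨c, rfl⟩ := mk_surjective x
    exact ⟨c * a, c * b, rfl, rfl, by rw [← mul_add]; rfl⟩
  one_ne_zero' := fun h => one_ne_zero (mk_eq_zero.1 h : (1 : K) = 0)
  exists_inv x hx := by
    obtain ⟨a, rfl⟩ := mk_surjective x
    have ha : a ≠ 0 := fun h => hx (mk_eq_zero.2 h)
    exact ⟨mk T a⁻¹, by rw [mk_mul, mul_inv_cancel₀ ha, mk_one]⟩

end QuotientHyperfield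

end Quotient

/-! ### The quadratic hyperfield -/

/-- The quadratic hyperfield `Q(K)`: the prime of `K /ₘ Kˣ²`. -/
abbrev QuadraticHyperfield (K : Type*) [Field K] : Type _ :=
  Hyperfield.Prime (QuotientHyperfield K (Subgroup.square Kˣ))

/-- The set of classes in `Q(K)` of the elements of a subgroup `T` of `Kˣ`.
For `Kˣ² ≤ T` this is the subgroup `T / Kˣ²` of `Q(K)ˣ = Kˣ / Kˣ²`. -/
def squareClasses {K : Type*} [Field K] (T : Subgroup Kˣ) : Set (QuadraticHyperfield K) :=
  (fun x : Kˣ => QuotientHyperfield.mk (Subgroup.square Kˣ) (x : K)) '' (T : Set Kˣ)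

/-! ### Subgroups attached to a valuation -/

/-- The subgroup `U_v Kˣ²`, where `U_v` is the group of units of the valuation ring. -/
noncomputable def unitsMulSquares {K Γ₀ : Type*} [Field K] [LinearOrderedCommGroupWithZero Γ₀]
    (v : Valuation K Γ₀) : Subgroup Kˣ :=
  v.valuationSubring.unitGroup ⊔ Subgroup.square Kˣ

/-- The subgroup `(1 + M_v) Kˣ²`, where `M_v` is the maximal ideal of the valuation ring. -/
noncomputable def principalUnitsMulSquares {K Γ₀ : Type*} [Field K] [LinearOrderedCommGroupWithZero Γ₀]
    (v : Valuation K Γ₀) : Subgroup Kˣ :=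
  v.valuationSubring.principalUnitGroup ⊔ Subgroup.square Kˣ

theorem mem_unitsMulSquares {K Γ₀ : Type*} [Field K] [LinearOrderedCommGroupWithZero Γ₀]
    (v : Valuation K Γ₀) (x : Kˣ) :
    x ∈ unitsMulSquares v ↔ ∃ u c : Kˣ, v u = 1 ∧ x = u * c ^ 2 := by
  rw [unitsMulSquares, Subgroup.mem_sup]
  simp only [Subgroup.mem_square, isSquare_iff_exists_sq, ValuationSubring.mem_unitGroup_iff,
    (Valuation.isEquiv_iff_val_eq_one.1 v.isEquiv_valuation_valuationSubring).symm]
  constructor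
  · rintro ⟨u, hu, _, ⟨c, rfl⟩, rfl⟩
    exact ⟨u, c, hu, rfl⟩
  · rintro ⟨u, c, hu, rfl⟩
    exact ⟨u, hu, _, ⟨c, rfl⟩, rfl⟩

theorem mem_principalUnitsMulSquares {K Γ₀ : Type*} [Field K] [LinearOrderedCommGroupWithZero Γ₀]
    (v : Valuation K Γ₀) (x : Kˣ) :
    x ∈ principalUnitsMulSquares v ↔ ∃ u c : Kˣ, v ((u : K) - 1) < 1 ∧ x = u * c ^ 2 := by
  rw [principalUnitsMulSquares, Subgroup.mem_sup]
  simp only [Subgroup.mem_square, isSquare_iff_exists_sq,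
    ValuationSubring.mem_principalUnitGroup_iff,
    (Valuation.isEquiv_iff_val_lt_one.1 v.isEquiv_valuation_valuationSubring).symm]
  constructor
  · rintro ⟨u, hu, _, ⟨c, rfl⟩, rfl⟩
    exact ⟨u, c, hu, rfl⟩
  · rintro ⟨u, c, hu, rfl⟩
    exact ⟨u, hu, _, ⟨c, rfl⟩, rfl⟩

/-! ### Rigid and basic elements -/

/-- `x` is `T`-rigid: `T + T x ⊆ T ∪ T x` (sums taken in the field `K`). -/
def IsRigid {K : Type*} [Field K] (T : Subgroup Kˣ) (x : Kˣ) : Prop :=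
  ∀ s ∈ T, ∀ t ∈ T, ∃ r ∈ T, (s + t * x : K) = r ∨ (s + t * x : K) = r * x

/-- The basic part `B(T)`. -/
def basicPart {K : Type*} [Field K] (T : Subgroup Kˣ) : Set Kˣ :=
  {x | ¬ IsRigid T x ∨ ¬ IsRigid T (-x)}

/-- `T` is exceptional: `B(T) = ±T` and either `-1 ∈ T` or `T` is additively closed. -/
def IsExceptional {K : Type*} [Field K] (T : Subgroup Kˣ) : Prop :=
  basicPart T = {x | x ∈ T ∨ -x ∈ T} ∧
    (-1 ∈ T ∨ ∀ s ∈ T, ∀ t ∈ T, ∃ r ∈ T, (s + t : K) = r)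

/-!
Put `T = (1 + M_v) Kˣ²`, and let `S ≤ Lˣ` be the subgroup corresponding to `T` under `α`. Everything
rests on recognizing valuations by rigid elements.

*Valuations from rigidity.* Let `H ≥ T` be a subgroup containing the basic part `B(T)`. Call `a ∉ H`
infinitesimal if `1 - a ∈ T`; rigidity implies that exactly one of `x`, `x⁻¹` is infinitesimal for
every `x ∉ H`. If `1 - a b ∈ T` for all infinitesimals `a`, `b` (`MulCompatible`), then the
infinitesimals generate an additive group `N` with `1 + N ⊆ T`, and `{x | x N ⊆ N}` is a valuation
ring with `1 + M ⊆ T` and units in `H` (`exists_valuationSubring_of_mulCompatible`). The condition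
`MulCompatible` can fail only for `a`, `b` in a single coset of `H`, so it holds after enlarging `H`
to `H ∪ a H` (`exists_mulCompatible`), and it holds for `H` itself if `T` is unexceptional
(`mulCompatible_of_not_isRigid`).

*Transport.* `T` is exceptional exactly if every element outside `-T` is `T`-rigid, a property
which passes to larger groups (`isExceptional_iff_isTotallyRigid`, `IsTotallyRigid.mono`). The prime
addition determines the rigidity of elements outside `-T` (`Corresponds.isRigid`), so `B(T)` and
exceptionality are transported by `α`.

*The two inclusions.* Applied to `S`, the existence theorem yields a valuation `w` of `L` with
`1 + M_w ⊆ S` and with units in `B(S)`, or in a group of index at most two over `S` in case (ii).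
For the inclusion `S ⊆ (1 + M_w) Lˣ²`, pull the right-hand side back to `T₁ ≤ T` and apply the
existence theorem to `T₁`, which yields a valuation `v'` of `K` with `1 + M_{v'} ⊆ T₁`. If `v'` was
not finer than `v`, then `v` would be nontrivial on the units of `v'`. Since the value group of `v`
is finitely generated, hence has no nontrivial 2-divisible subgroup, some unit of `v'` would then
lie outside `U_v Kˣ²` (`Valuation.exists_unit_notMem_unitsMulSquares`), which contradicts the bound
on the units of `v'`; in case (ii), this element is combined with a common unit of `v` and `v'`
outside `T` (`Valuation.exists_unit_notMem_principalUnitsMulSquares`). Hence `1 + M_v ⊆ 1 + M_{v'} ⊆ T₁`, so `T = T₁`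
(`transport_le_principalUnitsMulSquares`). The remaining claims follow from `B(S) ⊆ U_w Lˣ²` and by
counting cosets.
-/

/-! ### Rigid elements and the valuation ring they define -/

section RigidElements

variable {F : Type*} [Field F] {T H : Subgroup Fˣ}

/-- The subgroup `H` contains `T`, `-1` and the squares, and every element outside `H` is
`T`-rigid. For `H` containing `T` and `-1`, the last condition says that `H` contains the basic
part of `T`. -/
structure RigidOutside (T H : Subgroup Fˣ) : Prop where
  mul_self_mem : ∀ x, x * x ∈ T
  le : T ≤ H
  neg_one_mem : -1 ∈ H
  rigid : ∀ x ∉ H, IsRigid T x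

/-- The elements `a ∉ H` with `1 - a ∈ T`. If a valuation satisfies `1 + M ⊆ T` and `U ⊆ H`, these
are exactly the elements of `M` outside `H`. -/
def infinitesimals (T H : Subgroup Fˣ) : Set Fˣ :=
  {a | a ∉ H ∧ ∃ r ∈ T, (r : F) = 1 - a}

/-- The condition `1 - a b ∈ T` for all `a`, `b` in `infinitesimals T H`; it decides whether
`infinitesimals T H` comes from a valuation. -/
def MulCompatible (T H : Subgroup Fˣ) : Prop :=
  ∀ a ∈ infinitesimals T H, ∀ b ∈ infinitesimals T H, ∃ r ∈ T, (r : F) = 1 - a * b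

namespace RigidOutside

theorem neg_mem_iff (h : RigidOutside T H) {x : Fˣ} : -x ∈ H ↔ x ∈ H := by
  rw [← neg_one_mul, H.mul_mem_cancel_left h.neg_one_mem]

theorem mem_of_mul_eq_mul (h : RigidOutside T H) {r s a b : Fˣ} (hr : r ∈ T) (hs : s ∈ T)
    (hab : r * a = s * b) : a * b ∈ T := by
  have : a * b = r⁻¹ * s * (b * b) := by
    rw [mul_assoc, ← mul_assoc s, ← hab]; group
  rw [this]
  exact T.mul_mem (T.mul_mem (T.inv_mem hr) hs) (h.mul_self_mem b)

theorem mem_or_inv_mem (h : RigidOutside T H) {x : Fˣ} (hx : x ∉ H) :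
    x ∈ infinitesimals T H ∨ x⁻¹ ∈ infinitesimals T H := by
  obtain ⟨r, hr, h1 | h1⟩ := h.rigid (-x) (fun h' => hx (h.neg_mem_iff.1 h')) 1 T.one_mem 1 T.one_mem
  · left
    refine ⟨hx, r, hr, ?_⟩
    rw [← h1]; push_cast; ring
  · right
    refine ⟨fun h' => hx (by simpa using h'), r, hr, ?_⟩
    push_cast at h1 ⊢
    field_simp
    linear_combination h1

theorem inv_notMem (h : RigidOutside T H) {x : Fˣ} (hx : x ∈ infinitesimals T H) :
    x⁻¹ ∉ infinitesimals T H := by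
  rintro ⟨-, s, hs, hs'⟩
  obtain ⟨hxH, r, hr, hr'⟩ := hx
  apply hxH
  rw [← h.neg_mem_iff]
  have : -x = r * s⁻¹ := by
    rw [eq_mul_inv_iff_mul_eq]
    ext
    push_cast at hs' ⊢
    rw [hs', hr']
    field_simp
    ring
  rw [this]
  exact H.mul_mem (h.le hr) (H.inv_mem (h.le hs))

theorem exists_one_sub_mul (h : RigidOutside T H) {a b : Fˣ} (ha : a ∈ infinitesimals T H)
    (hb : b ∈ infinitesimals T H) :
    ∃ r ∈ T, (1 - a * b : F) = r ∨ (1 - a * b : F) = r * a := by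
  obtain ⟨haH, s, hs, hs'⟩ := ha
  obtain ⟨-, t, ht, ht'⟩ := hb
  obtain ⟨r, hr, h1⟩ := h.rigid a haH s hs t ht
  refine ⟨r, hr, ?_⟩
  have : (1 - a * b : F) = s + t * a := by rw [hs', ht']; ring
  rwa [this]

/-- The identity `1 - a b = (1 - a) + a (1 - b)` shows `1 - a b ∈ (T ∪ a T) ∩ (T ∪ b T)`. -/
theorem one_sub_mul_of_mul_notMem (h : RigidOutside T H) {a b : Fˣ} (ha : a ∈ infinitesimals T H)
    (hb : b ∈ infinitesimals T H) (hab : a * b ∉ T) : ∃ r ∈ T, (r : F) = 1 - a * b := by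
  obtain ⟨r, hr, h1 | h1⟩ := h.exists_one_sub_mul ha hb
  · exact ⟨r, hr, h1.symm⟩
  obtain ⟨s, hs, h2 | h2⟩ := h.exists_one_sub_mul hb ha
  · exact ⟨s, hs, by rw [← h2, mul_comm]⟩
  refine absurd (h.mem_of_mul_eq_mul hr hs ?_) hab
  ext
  push_cast
  rw [← h1, ← h2, mul_comm]

/-- If `1 - a b ∉ T`, then every infinitesimal outside `H ∪ a H` is infinitesimal
relative to `a`. -/
theorem div_mem_of_not_one_sub_mul (h : RigidOutside T H) {a b c : Fˣ}
    (ha : a ∈ infinitesimals T H) (hb : b ∈ infinitesimals T H)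
    (hab : ¬ ∃ r ∈ T, (r : F) = 1 - a * b) (hc : c ∈ infinitesimals T H) (hac : c * a⁻¹ ∉ H) :
    c * a⁻¹ ∈ infinitesimals T H := by
  refine (h.mem_or_inv_mem hac).resolve_right fun h1 => ?_
  have habT : a * b ∈ T := by
    by_contra h'
    exact hab (h.one_sub_mul_of_mul_notMem ha hb h')
  have hbcH : b * c ∉ H := by
    intro h'
    apply hac
    have : c * a⁻¹ = (a * b)⁻¹ * (b * c) := by
      rw [mul_inv_rev, mul_comm b c, mul_comm b⁻¹]
      calc c * a⁻¹ = a⁻¹ * c := mul_comm _ _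
        _ = a⁻¹ * b⁻¹ * (c * b) := by rw [mul_comm c b]; group
    rw [this]
    exact H.mul_mem (H.inv_mem (h.le habT)) h'
  obtain ⟨p, hp, hp'⟩ := h.one_sub_mul_of_mul_notMem hb hc (fun h' => hbcH (h.le h'))
  obtain ⟨-, q, hq, hq'⟩ := h1
  obtain ⟨r, hr, h2⟩ := h.rigid _ hbcH p hp q hq
  -- `1 - a b = (1 - b c) + b c (1 - a / c)`
  have h3 : (p + q * (b * c : Fˣ) : F) = 1 - a * b := by
    rw [hp', hq']; push_cast; field_simp; ring
  rw [h3] at h2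
  rcases h2 with h2 | h2
  · exact hab ⟨r, hr, h2.symm⟩
  obtain ⟨s, hs, h4 | h4⟩ := h.exists_one_sub_mul ha hb
  · exact hab ⟨s, hs, h4.symm⟩
  refine hc.1 (h.le ?_)
  have h5 : a * (b * c) ∈ T := h.mem_of_mul_eq_mul hs hr (by
    ext; push_cast at h2 ⊢; rw [← h4, ← h2])
  rw [← mul_assoc] at h5
  exact (T.mul_mem_cancel_left habT).1 h5

/-- If `1 - a b ∉ T` for infinitesimals `a`, `b`, then `H ∪ a H` is compatible: an infinitesimal `c`
violating compatibility outside `H ∪ a H` would be both larger and smaller than `a`. -/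
theorem exists_mulCompatible (h : RigidOutside T H) :
    ∃ H' : Subgroup Fˣ, H ≤ H' ∧ (∀ x ∈ H', ∀ y ∈ H', x ∉ H → y ∉ H → x * y ∈ H) ∧
      RigidOutside T H' ∧ MulCompatible T H' := by
  by_cases hc : MulCompatible T H
  · exact ⟨H, le_rfl, fun x hx _ _ hx' => absurd hx hx', h, hc⟩
  simp only [MulCompatible, not_forall] at hc
  obtain ⟨a, ha, b, hb, hab⟩ := hc
  -- the subgroup `H ∪ a H`
  let H' : Subgroup Fˣ :=
    { carrier := {x | x ∈ H ∨ x * a⁻¹ ∈ H}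
      one_mem' := Or.inl H.one_mem
      mul_mem' := by
        rintro x y (hx | hx) (hy | hy)
        · exact .inl (H.mul_mem hx hy)
        · exact .inr (by rw [mul_assoc]; exact H.mul_mem hx hy)
        · exact .inr (by rw [mul_right_comm]; exact H.mul_mem hx hy)
        · left
          have : x * y = x * a⁻¹ * (y * a⁻¹) * (a * a) := by
            rw [mul_mul_mul_comm x]; group
          rw [this]
          exact H.mul_mem (H.mul_mem hx hy) (h.le (h.mul_self_mem a))
      inv_mem' := by
        rintro x (hx | hx)
        · exact .inl (H.inv_mem hx)
        · right
          have : x⁻¹ * a⁻¹ = (x * a⁻¹)⁻¹ * (a * a)⁻¹ := by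
            rw [mul_inv_rev, mul_inv_rev, mul_comm _ x⁻¹]; group
          rw [this]
          exact H.mul_mem (H.inv_mem hx) (H.inv_mem (h.le (h.mul_self_mem a))) }
  have hle : H ≤ H' := fun x hx => Or.inl hx
  refine ⟨H', hle, ?_, ⟨h.mul_self_mem, h.le.trans hle, hle h.neg_one_mem,
    fun x hx => h.rigid x fun hx' => hx (hle hx')⟩, ?_⟩
  · rintro x (hx | hx) y (hy | hy) hx' hy'
    · exact absurd hx hx'
    · exact absurd hx hx'
    · exact absurd hy hy'
    · have : x * y = x * a⁻¹ * (y * a⁻¹) * (a * a) := by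
        rw [mul_mul_mul_comm x]; group
      rw [this]
      exact H.mul_mem (H.mul_mem hx hy) (h.le (h.mul_self_mem a))
  · intro c hc d hd
    have hc1 : c ∈ infinitesimals T H := ⟨fun h' => hc.1 (hle h'), hc.2⟩
    have hd1 : d ∈ infinitesimals T H := ⟨fun h' => hd.1 (hle h'), hd.2⟩
    have hca : c * a⁻¹ ∉ H := fun h' => hc.1 (Or.inr h')
    by_contra hcd
    -- `c / a` and `a / c` would both be infinitesimal
    refine h.inv_notMem (h.div_mem_of_not_one_sub_mul ha hb hab hc1 hca) ?_
    have hac : a * c⁻¹ ∉ H := fun h' => hca (by simpa using H.inv_mem h')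
    simpa using h.div_mem_of_not_one_sub_mul hc1 hd1 hcd ha hac

/-- A non-rigid `b ∉ -T` excludes any failure `1 - a a' ∉ T`. After scaling, `e = 1 + b` is not in
`T ∪ b T`; comparing `a e` with `1` leads to a contradiction. -/
theorem mulCompatible_of_not_isRigid (h : RigidOutside T H) {b : Fˣ} (hb : ¬ IsRigid T b)
    (hbT : -b ∉ T) : MulCompatible T H := by
  have hbH : b ∈ H := by
    by_contra h'
    exact hb (h.rigid b h')
  simp only [IsRigid, not_forall] at hb
  obtain ⟨s, hs, t, ht, hst⟩ := hb
  obtain ⟨c, hcb⟩ : ∃ c : Fˣ, c = s⁻¹ * t * b := ⟨_, rfl⟩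
  have hq : s⁻¹ * t ∈ T := T.mul_mem (T.inv_mem hs) ht
  have hcH : c ∈ H := by rw [hcb]; exact H.mul_mem (h.le hq) hbH
  have hcT : -c ∉ T := by
    rw [hcb, ← mul_neg, T.mul_mem_cancel_left hq]; exact hbT
  have hsc : (s + t * b : F) = s * (1 + c) := by
    rw [hcb]; push_cast; field_simp
  rw [hsc] at hst
  have he0 : (1 + c : F) ≠ 0 := fun h' => hcT (by
    have : c = -1 := by ext; push_cast; linear_combination h'
    rw [this, neg_neg]; exact T.one_mem)
  obtain ⟨e, he⟩ : ∃ e : Fˣ, (e : F) = 1 + c := ⟨Units.mk0 _ he0, rfl⟩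
  rw [← he] at hst
  have heT : e ∉ T := fun h' => hst ⟨s * e, T.mul_mem hs h', Or.inl (by push_cast; rfl)⟩
  have hecT : e * c⁻¹ ∉ T := fun h' => hst ⟨t * (e * c⁻¹), T.mul_mem ht h', Or.inr (by
    rw [hcb]; push_cast; field_simp)⟩
  have heH : e ∈ H := by
    by_contra h'
    obtain ⟨r, hr, h1 | h1⟩ := h.rigid (-e) (fun h2 => h' (h.neg_mem_iff.1 h2))
      1 T.one_mem 1 T.one_mem
    · apply hcT
      convert hr using 1
      ext; push_cast at h1 ⊢; rw [← h1, he]; ring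
    · apply hecT
      rw [← T.inv_mem_iff]
      convert hr using 1
      ext; push_cast at h1 ⊢; field_simp
      linear_combination -he - h1
  intro a ha a' ha'
  by_contra hab
  have haa' : a * a' ∈ T := by
    by_contra h'
    exact hab (h.one_sub_mul_of_mul_notMem ha ha' h')
  have haeH : a * e ∉ H := fun h' => ha.1 ((H.mul_mem_cancel_right heH).1 h')
  rcases h.mem_or_inv_mem haeH with h1 | h1
  · obtain ⟨q, hq, hq'⟩ := h.one_sub_mul_of_mul_notMem h1 ha' (by
      rw [mul_right_comm, T.mul_mem_cancel_left haa']; exact heT)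
    obtain ⟨r, hr, h2 | h2⟩ := h.exists_one_sub_mul ha ha'
    · exact hab ⟨r, hr, h2.symm⟩
    -- `q - r a = - a a' c`
    obtain ⟨p, hp, h3⟩ := h.rigid (-a) (fun h2 => ha.1 (h.neg_mem_iff.1 h2)) q hq r hr
    have h4 : (q + r * (-a : Fˣ) : F) = (a * a' * -c : Fˣ) := by
      push_cast at hq' ⊢
      rw [hq', he]; linear_combination h2
    rw [h4] at h3
    rcases h3 with h3 | h3
    · have : a * a' * -c = p := by ext; exact h3
      exact hcT ((T.mul_mem_cancel_left haa').1 (this ▸ hp))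
    · have h5 : a * a' * -c = p * -a := by ext; push_cast at h3 ⊢; exact h3
      have h6 : a * a' * -c ∈ H := H.mul_mem (h.le haa') (h.neg_mem_iff.2 hcH)
      rw [h5] at h6
      exact ha.1 (h.neg_mem_iff.1 ((H.mul_mem_cancel_left (h.le hp)).1 h6))
  · have h2 : a * (a * e)⁻¹ = e⁻¹ := by rw [mul_inv, mul_inv_cancel_left]
    obtain ⟨q, hq, hq'⟩ := h.one_sub_mul_of_mul_notMem ha h1 (by
      rw [h2, T.inv_mem_iff]; exact heT)
    apply hecT
    rw [← T.inv_mem_iff]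
    convert hq using 1
    ext; push_cast at hq' ⊢; rw [hq']; field_simp; linear_combination -he

end RigidOutside

end RigidElements

/-! ### The valuation ring attached to compatible infinitesimals -/

section ValuationRing

variable {F : Type*} [Field F] {T H : Subgroup Fˣ}

namespace RigidOutside

theorem neg_mem_infinitesimals (h : RigidOutside T H) (hc : MulCompatible T H) {a : Fˣ}
    (ha : a ∈ infinitesimals T H) : -a ∈ infinitesimals T H := by
  refine ⟨fun h' => ha.1 (h.neg_mem_iff.1 h'), ?_⟩
  obtain ⟨r, hr, h1 | h1⟩ := h.rigid a ha.1 1 T.one_mem 1 T.one_mem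
  · exact ⟨r, hr, by rw [← h1]; push_cast; ring⟩
  -- otherwise `1 - a ^ 2 = (1 - a) (1 + a)` would lie in `a T`, which is disjoint from `T`
  · obtain ⟨p, hp, hp'⟩ := hc a ha a ha
    obtain ⟨s, hs, hs'⟩ := ha.2
    refine absurd (h.le ?_) ha.1
    have : a = (s * r)⁻¹ * p := by
      rw [eq_inv_mul_iff_mul_eq]
      ext
      push_cast at h1 ⊢
      rw [hp', hs']
      linear_combination (-(1 - a) : F) * h1
    rw [this]
    exact T.mul_mem (T.inv_mem (T.mul_mem hs hr)) hp

theorem mul_one_sub_mem (h : RigidOutside T H) (hc : MulCompatible T H) {a b s : Fˣ}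
    (ha : a ∈ infinitesimals T H) (hb : b ∈ infinitesimals T H) (hs : (s : F) = 1 - a) :
    b * s ∈ infinitesimals T H := by
  have hsT : s ∈ T := by
    obtain ⟨r, hr, hr'⟩ := ha.2
    rwa [show s = r by ext; rw [hs, hr']]
  have hH : b * s ∉ H := fun h' => hb.1 ((H.mul_mem_cancel_right (h.le hsT)).1 h')
  refine (h.mem_or_inv_mem hH).resolve_right fun h1 => ?_
  obtain ⟨p, hp, hp'⟩ := hc b hb _ h1
  -- `1 - 1 / (1 - a) = -a / (1 - a)`
  refine ha.1 (h.neg_mem_iff.1 (h.le ?_))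
  have : -a = p * s := by
    ext
    push_cast at hp' ⊢
    rw [hp']
    field_simp
    rw [hs]; ring
  rw [this]
  exact T.mul_mem hp hsT

theorem mul_inv_one_sub_mem (h : RigidOutside T H) (hc : MulCompatible T H) {a b s : Fˣ}
    (ha : a ∈ infinitesimals T H) (hb : b ∈ infinitesimals T H) (hs : (s : F) = 1 - a) :
    b * s⁻¹ ∈ infinitesimals T H := by
  have hsT : s ∈ T := by
    obtain ⟨r, hr, hr'⟩ := ha.2
    rwa [show s = r by ext; rw [hs, hr']]
  have hH : b * s⁻¹ ∉ H := fun h' =>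
    hb.1 ((H.mul_mem_cancel_right (H.inv_mem (h.le hsT))).1 h')
  refine (h.mem_or_inv_mem hH).resolve_right fun h1 => ?_
  obtain ⟨p, hp, hp'⟩ := hc b hb _ h1
  -- `1 - (1 - a) = a`
  refine ha.1 (h.le ?_)
  have : a = p := by
    ext
    push_cast at hp' ⊢
    rw [hp']
    field_simp
    rw [hs]; ring
  rwa [this]

/-- The additive subgroup generated by `infinitesimals T H`. -/
def infinitesimalGroup (T H : Subgroup Fˣ) : AddSubgroup F :=
  AddSubgroup.closure ((↑) '' infinitesimals T H)

theorem coe_mem_infinitesimalGroup {a : Fˣ} (ha : a ∈ infinitesimals T H) :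
    (a : F) ∈ infinitesimalGroup T H :=
  AddSubgroup.subset_closure ⟨a, ha, rfl⟩

/-- By induction on the number of summands, as `1 - a - z = (1 - a) (1 - z / (1 - a))` and division
by `1 - a` preserves infinitesimals. -/
theorem one_sub_mem_of_mem_infinitesimalGroup (h : RigidOutside T H) (hc : MulCompatible T H)
    {z : F} (hz : z ∈ infinitesimalGroup T H) : ∃ r ∈ T, (r : F) = 1 - z := by
  suffices hu : ∀ u : Fˣ, (∀ a ∈ infinitesimals T H, a * u ∈ infinitesimals T H) →
      ∃ r ∈ T, (r : F) = 1 - z * u by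
    simpa using hu 1 (by simp)
  have key : ∀ a ∈ infinitesimals T H, ∀ y : F,
      (∀ u : Fˣ, (∀ a ∈ infinitesimals T H, a * u ∈ infinitesimals T H) →
        ∃ r ∈ T, (r : F) = 1 - y * u) →
      ∀ u : Fˣ, (∀ a ∈ infinitesimals T H, a * u ∈ infinitesimals T H) →
        ∃ r ∈ T, (r : F) = 1 - (a + y) * u := by
    intro a ha y hy u hu
    obtain ⟨s, hs, hs'⟩ := (hu a ha).2
    obtain ⟨r, hr, hr'⟩ := hy (u * s⁻¹) (fun b hb => by
      rw [← mul_assoc]; exact h.mul_inv_one_sub_mem hc (hu a ha) (hu b hb) hs')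
    refine ⟨s * r, T.mul_mem hs hr, ?_⟩
    push_cast at hs' hr' ⊢
    rw [hr']
    field_simp
    rw [hs']; ring
  refine AddSubgroup.closure_induction_left
    (p := fun z _ => ∀ u : Fˣ, (∀ a ∈ infinitesimals T H, a * u ∈ infinitesimals T H) →
      ∃ r ∈ T, (r : F) = 1 - z * u) ?_ ?_ ?_ hz
  · exact fun u _ => ⟨1, T.one_mem, by simp⟩
  · rintro _ ⟨a, ha, rfl⟩ y _ hy
    exact key a ha y hy
  · rintro _ ⟨a, ha, rfl⟩ y _ hy
    simpa using key (-a) (h.neg_mem_infinitesimals hc ha) y hy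

/-- As `a b = b - b (1 - a)`. -/
theorem mul_mem_infinitesimalGroup (h : RigidOutside T H) (hc : MulCompatible T H)
    {a : Fˣ} (ha : a ∈ infinitesimals T H) {z : F} (hz : z ∈ infinitesimalGroup T H) :
    (a : F) * z ∈ infinitesimalGroup T H := by
  refine AddSubgroup.closure_induction (p := fun z _ => (a : F) * z ∈ infinitesimalGroup T H)
    ?_ ?_ ?_ ?_ hz
  · rintro _ ⟨b, hb, rfl⟩
    obtain ⟨s, -, hs⟩ := ha.2
    have h1 := coe_mem_infinitesimalGroup (h.mul_one_sub_mem hc ha hb hs)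
    have h2 : (a * b : F) = b - (b * s : Fˣ) := by push_cast; rw [hs]; ring
    rw [h2]
    exact sub_mem (coe_mem_infinitesimalGroup hb) h1
  · simp
  · intro x y _ _ hx hy
    rw [mul_add]; exact add_mem hx hy
  · intro x _ hx
    rw [mul_neg]; exact neg_mem hx

theorem mem_infinitesimals_of_mem_infinitesimalGroup (h : RigidOutside T H)
    (hc : MulCompatible T H) {x : Fˣ} (hx : x ∉ H) (hx' : (x : F) ∈ infinitesimalGroup T H) :
    x ∈ infinitesimals T H :=
  ⟨hx, h.one_sub_mem_of_mem_infinitesimalGroup hc hx'⟩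

/-- The multiplier ring of the additive group generated by the infinitesimals. -/
def multiplierRing (T H : Subgroup Fˣ) : Subring F where
  carrier := {x | ∀ z ∈ infinitesimalGroup T H, x * z ∈ infinitesimalGroup T H}
  mul_mem' hx hy z hz := by rw [mul_assoc]; exact hx _ (hy z hz)
  one_mem' z hz := by rwa [one_mul]
  add_mem' hx hy z hz := by rw [add_mul]; exact add_mem (hx z hz) (hy z hz)
  zero_mem' z _ := by rw [zero_mul]; exact zero_mem _
  neg_mem' hx z hz := by rw [neg_mul]; exact neg_mem (hx z hz)

/-- If `x ∈ H` does not multiply `infinitesimalGroup T H` into itself, then some `x a` with `a`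
infinitesimal is not infinitesimal. -/
theorem exists_inv_mul_mem (h : RigidOutside T H) {x : Fˣ} (hxH : x ∈ H)
    (hx : (x : F) ∉ multiplierRing T H) :
    ∃ a ∈ infinitesimals T H, (x * a)⁻¹ ∈ infinitesimals T H := by
  by_contra! hn
  refine hx fun z hz => AddSubgroup.closure_induction
    (p := fun z _ => (x : F) * z ∈ infinitesimalGroup T H) ?_ ?_ ?_ ?_ hz
  · rintro _ ⟨a, ha, rfl⟩
    have : x * a ∉ H := fun h' => ha.1 ((H.mul_mem_cancel_left hxH).1 h')
    rw [← Units.val_mul]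
    exact coe_mem_infinitesimalGroup ((h.mem_or_inv_mem this).resolve_right (hn a ha))
  · simp
  · intro x y _ _ hx hy
    rw [mul_add]; exact add_mem hx hy
  · intro x _ hx
    rw [mul_neg]; exact neg_mem hx

theorem mem_multiplierRing_of_mem (h : RigidOutside T H) (hc : MulCompatible T H) {a : Fˣ}
    (ha : a ∈ infinitesimals T H) : (a : F) ∈ multiplierRing T H :=
  fun _ hz => h.mul_mem_infinitesimalGroup hc ha hz

theorem mem_or_inv_mem_multiplierRing (h : RigidOutside T H) (hc : MulCompatible T H) (x : F) :
    x ∈ multiplierRing T H ∨ x⁻¹ ∈ multiplierRing T H := by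
  rcases eq_or_ne x 0 with rfl | hx0
  · exact .inl (zero_mem _)
  lift x to Fˣ using IsUnit.mk0 x hx0
  by_cases hxH : x ∈ H
  · by_contra! hn
    obtain ⟨a, ha, ha'⟩ := h.exists_inv_mul_mem hxH hn.1
    obtain ⟨b, hb, hb'⟩ := h.exists_inv_mul_mem (H.inv_mem hxH) (by simpa using hn.2)
    -- `a`, `1 / (x a)` and `b` are infinitesimal, hence so is their product `b / x`
    refine h.inv_notMem (h.mem_infinitesimals_of_mem_infinitesimalGroup hc (x := x⁻¹ * b)
      (fun h' => hb.1 ((H.mul_mem_cancel_left (H.inv_mem hxH)).1 h')) ?_) hb'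
    have := h.mul_mem_infinitesimalGroup hc ha (h.mul_mem_infinitesimalGroup hc ha'
      (coe_mem_infinitesimalGroup hb))
    convert this using 1
    push_cast
    field_simp
  · rcases h.mem_or_inv_mem hxH with h1 | h1
    · exact .inl (h.mem_multiplierRing_of_mem hc h1)
    · right
      simpa using h.mem_multiplierRing_of_mem hc h1

theorem exists_valuationSubring_of_mulCompatible (h : RigidOutside T H)
    (hc : MulCompatible T H) :
    ∃ A : ValuationSubring F, A.unitGroup ≤ H ∧ A.principalUnitGroup ≤ T := by
  let A : ValuationSubring F :=
    ValuationSubring.ofSubring (multiplierRing T H) (h.mem_or_inv_mem_multiplierRing hc)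
  have memA : ∀ x : F, x ∈ A ↔ x ∈ multiplierRing T H := fun x =>
    ValuationSubring.mem_ofSubring _ _ x
  have key : ∀ a ∈ infinitesimals T H, ((a⁻¹ : Fˣ) : F) ∉ A := by
    intro a ha ha'
    obtain ⟨r, -, hr⟩ := h.one_sub_mem_of_mem_infinitesimalGroup hc
      ((memA _).1 ha' _ (coe_mem_infinitesimalGroup ha))
    simp at hr
  refine ⟨A, fun x hx => ?_, fun x hx => ?_⟩
  · by_contra hxH
    rw [ValuationSubring.mem_unitGroup_iff] at hx
    rcases h.mem_or_inv_mem hxH with h1 | h1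
    · refine key x h1 ?_
      rw [← ValuationSubring.valuation_le_one_iff]
      simp [hx]
    · refine key _ h1 ?_
      rw [← ValuationSubring.valuation_le_one_iff]
      simp [hx]
  · rw [ValuationSubring.mem_principalUnitGroup_iff, ← ValuationSubring.mem_nonunits_iff] at hx
    -- it suffices that the maximal ideal is contained in the group of infinitesimals
    suffices hM : ∀ z ∈ A.nonunits, z ∈ infinitesimalGroup T H by
      obtain ⟨r, hr, hr'⟩ := h.one_sub_mem_of_mem_infinitesimalGroup hc (neg_mem (hM _ hx))
      rwa [show x = r by ext; rw [hr']; ring]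
    intro z hz
    rw [ValuationSubring.mem_nonunits_iff_or] at hz
    rcases hz with rfl | hz
    · exact zero_mem _
    rcases eq_or_ne z 0 with rfl | hz0
    · exact zero_mem _
    lift z to Fˣ using IsUnit.mk0 z hz0
    rw [memA, ← Units.val_inv_eq_inv_val] at hz
    by_cases hzH : z ∈ H
    · obtain ⟨a, ha, ha'⟩ := h.exists_inv_mul_mem (H.inv_mem hzH) hz
      have := h.mul_mem_infinitesimalGroup hc ha (coe_mem_infinitesimalGroup ha')
      convert this using 1
      push_cast
      field_simp
    · refine coe_mem_infinitesimalGroup ((h.mem_or_inv_mem hzH).resolve_right fun h1 => hz ?_)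
      exact h.mem_multiplierRing_of_mem hc h1

/-- If `B(T) ⊆ H`, there is a valuation with `1 + M ⊆ T` and `U ⊆ H'`, where `H'` has index at
most two over `H`. -/
theorem exists_valuationSubring (h : RigidOutside T H) :
    ∃ H' : Subgroup Fˣ, H ≤ H' ∧ (∀ x ∈ H', ∀ y ∈ H', x ∉ H → y ∉ H → x * y ∈ H) ∧
      ∃ A : ValuationSubring F, A.unitGroup ≤ H' ∧ A.principalUnitGroup ≤ T := by
  obtain ⟨H', h1, h2, h3, h4⟩ := h.exists_mulCompatible
  exact ⟨H', h1, h2, h3.exists_valuationSubring_of_mulCompatible h4⟩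

end RigidOutside

end ValuationRing

/-! ### Exceptional subgroups -/

section Exceptional

variable {F : Type*} [Field F] {T : Subgroup Fˣ}

/-- Every element outside `-T` is `T`-rigid. The elements of `-T` are never `T`-rigid, as
`T + T x` contains `0` for `x ∈ -T`. -/
def IsTotallyRigid (T : Subgroup Fˣ) : Prop :=
  ∀ x : Fˣ, -x ∉ T → IsRigid T x

theorem not_isRigid_of_neg_mem {x : Fˣ} (hx : -x ∈ T) : ¬ IsRigid T x := by
  intro h
  obtain ⟨r, -, h1 | h1⟩ := h (-x) hx 1 T.one_mem
  · push_cast at h1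
    exact r.ne_zero (by rw [← h1]; ring)
  · push_cast at h1
    exact (r * x).ne_zero (by push_cast; rw [← h1]; ring)

theorem mem_basicPart_of_mem {x : Fˣ} (hx : x ∈ T) : x ∈ basicPart T :=
  Or.inr (not_isRigid_of_neg_mem (by simpa using hx))

theorem neg_mem_basicPart_iff {x : Fˣ} : -x ∈ basicPart T ↔ x ∈ basicPart T := by
  simp only [basicPart, Set.mem_ofPred_eq, neg_neg]
  exact or_comm

theorem isExceptional_iff_isTotallyRigid : IsExceptional T ↔ IsTotallyRigid T := by
  constructor
  · rintro ⟨h1, h2⟩ x hx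
    by_contra hr
    have hxB : x ∈ basicPart T := Or.inl hr
    rw [h1] at hxB
    have hxT : x ∈ T := hxB.resolve_right hx
    have h3 : -1 ∉ T := fun h' => hx (by rw [← neg_one_mul]; exact T.mul_mem h' hxT)
    refine hr fun s hs t ht => ?_
    obtain ⟨r, hr, hr'⟩ := h2.resolve_left h3 s hs (t * x) (T.mul_mem ht hxT)
    exact ⟨r, hr, Or.inl (by rw [← hr']; push_cast; rfl)⟩
  · intro h
    refine ⟨Set.ext fun x => ⟨?_, ?_⟩, ?_⟩
    · rintro (hx | hx)
      · exact .inr (by by_contra h'; exact hx (h x h'))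
      · exact .inl (by by_contra h'; exact hx (h (-x) (by rwa [neg_neg])))
    · rintro (hx | hx)
      · exact mem_basicPart_of_mem hx
      · exact neg_mem_basicPart_iff.1 (mem_basicPart_of_mem hx)
    · by_cases h1 : -1 ∈ T
      · exact .inl h1
      · right
        intro s hs t ht
        obtain ⟨r, hr, hr'⟩ := h 1 h1 s hs t ht
        exact ⟨r, hr, by simpa using hr'⟩

/-- If `s`, `t` lie in the larger group `S`, then `s + t x = s (1 + x')` with `x' = s⁻¹ t x ∈ S x`,
and `x'` is `T`-rigid. -/
theorem IsTotallyRigid.mono {S : Subgroup Fˣ} (h : IsTotallyRigid T) (hTS : T ≤ S) :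
    IsTotallyRigid S := by
  intro x hx s hs t ht
  have hx' : -(s⁻¹ * t * x) ∉ T := fun h' => hx (by
    have h2 := hTS h'
    rwa [← mul_neg, S.mul_mem_cancel_left (S.mul_mem (S.inv_mem hs) ht)] at h2)
  have h3 : (s + t * x : F) = s * (1 + (s⁻¹ * t * x : Fˣ)) := by
    push_cast; field_simp
  obtain ⟨r, hr, h1 | h1⟩ := h _ hx' 1 T.one_mem 1 T.one_mem
  · refine ⟨s * r, S.mul_mem hs (hTS hr), .inl ?_⟩
    rw [h3]; push_cast at h1 ⊢; rw [← h1]; ring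
  · refine ⟨t * r, S.mul_mem ht (hTS hr), .inr ?_⟩
    rw [h3]; push_cast at h1 ⊢
    field_simp at h1 ⊢
    linear_combination h1

theorem RigidOutside.of_basicPart_subset {H : Subgroup Fˣ} (hsq : Subgroup.square Fˣ ≤ T)
    (hB : basicPart T ⊆ H) : RigidOutside T H where
  mul_self_mem x := hsq (Subgroup.mem_square.2 ⟨x, rfl⟩)
  le x hx := hB (mem_basicPart_of_mem hx)
  neg_one_mem := hB (Or.inl (not_isRigid_of_neg_mem (by simp)))
  rigid x hx := by
    by_contra h'
    exact hx (hB (Or.inl h'))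

/-- For unexceptional `T`, the group `H` itself contains the units. -/
theorem exists_valuationSubring_of_not_isTotallyRigid {H : Subgroup Fˣ}
    (hsq : Subgroup.square Fˣ ≤ T) (hB : basicPart T ⊆ H) (hT : ¬ IsTotallyRigid T) :
    ∃ A : ValuationSubring F, A.unitGroup ≤ H ∧ A.principalUnitGroup ≤ T := by
  have h := RigidOutside.of_basicPart_subset hsq hB
  simp only [IsTotallyRigid, not_forall] at hT
  obtain ⟨b, hb, hb'⟩ := hT
  exact h.exists_valuationSubring_of_mulCompatible (h.mulCompatible_of_not_isRigid hb' hb)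

end Exceptional

/-! ### Comparison of two valuations -/

section Comparison

/-- A 2-divisible subgroup of a finitely generated torsion-free abelian group is trivial, by
Nakayama's lemma over `ℤ`. -/
theorem Subgroup.eq_one_of_mem_of_two_divisible {G : Type*} [CommGroup G] [IsMulTorsionFree G]
    {V D : Subgroup G} (hV : V.FG) (hDV : D ≤ V) (hD : ∀ d ∈ D, ∃ c ∈ D, c ^ 2 = d)
    {d : G} (hd : d ∈ D) : d = 1 := by
  have : Group.FG V := (Group.fg_iff_subgroup_fg V).2 hV
  have : Module.Finite ℤ (Additive V) := Module.Finite.iff_addGroup_fg.2 inferInstance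
  let N : Submodule ℤ (Additive V) :=
    AddSubgroup.toIntSubmodule (Subgroup.toAddSubgroup (D.subgroupOf V))
  have memN : ∀ x : V, Additive.ofMul x ∈ N ↔ (x : G) ∈ D := fun x => Iff.rfl
  obtain ⟨r, hr, h⟩ := Submodule.exists_sub_one_mem_and_smul_eq_zero_of_fg_of_le_smul
    (Ideal.span {(2 : ℤ)}) N (IsNoetherian.noetherian N) (by
      intro n hn
      obtain ⟨c, hc, hcn⟩ := hD _ ((memN n.toMul).1 hn)
      have : n = (2 : ℤ) • Additive.ofMul (⟨c, hDV hc⟩ : V) := by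
        apply Additive.toMul.injective
        apply Subtype.ext
        simp [← hcn]
      rw [this]
      exact Submodule.smul_mem_smul (Ideal.mem_span_singleton_self 2) ((memN _).2 hc))
  have hr0 : r ≠ 0 := by
    rintro rfl
    rw [Ideal.mem_span_singleton] at hr
    omega
  have h1 := h (Additive.ofMul ⟨d, hDV hd⟩) ((memN _).2 hd)
  have h2 : d ^ r = 1 := by
    have := congrArg (fun x : Additive V => ((x.toMul : V) : G)) h1
    simpa using this
  exact (IsMulTorsionFree.zpow_eq_one_iff_left hr0).1 h2

variable {K Γ₀ Γ₁ : Type*} [Field K] [LinearOrderedCommGroupWithZero Γ₀]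
  [LinearOrderedCommGroupWithZero Γ₁] (v : Valuation K Γ₀) (w : Valuation K Γ₁)

/-- The values at `v` of units of `w` form a convex set. -/
theorem Valuation.exists_unit_of_lt {u z : Kˣ} (hu : w u = 1) (huz : v u < v z) (hz : v z < 1) :
    ∃ x : Kˣ, w x = 1 ∧ v x = v z := by
  suffices h : ∃ x : K, w x = 1 ∧ v x = v z by
    obtain ⟨x, h1, h2⟩ := h
    have hx : x ≠ 0 := by rintro rfl; simp at h1
    exact ⟨Units.mk0 x hx, h1, h2⟩
  rcases lt_trichotomy (w z) 1 with h | h | h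
  · refine ⟨u + z, ?_, v.map_add_eq_of_lt_right huz⟩
    rw [w.map_add_eq_of_lt_left (by rwa [hu]), hu]
  · exact ⟨z, h, rfl⟩
  · refine ⟨z / (1 + z), ?_, ?_⟩
    · rw [map_div₀, w.map_add_eq_of_lt_right (by rwa [map_one]), div_self]
      exact (w.ne_zero_iff).2 z.ne_zero
    · rw [map_div₀, v.map_add_eq_of_lt_left (by rwa [map_one]), map_one, div_one]

theorem Valuation.exists_unit_lt_one {y : K} (hw : w y ≤ 1) (hv : 1 < v y) :
    ∃ u : Kˣ, w u = 1 ∧ v u < 1 := by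
  obtain ⟨x, hx1, hx2⟩ : ∃ x : K, w x = 1 ∧ 1 < v x := by
    rcases hw.lt_or_eq with h | h
    · refine ⟨1 + y, ?_, ?_⟩
      · rw [w.map_add_eq_of_lt_left (by rwa [map_one]), map_one]
      · rwa [v.map_add_eq_of_lt_right (by rwa [map_one])]
    · exact ⟨y, h, hv⟩
  have hx : x ≠ 0 := by rintro rfl; simp at hx1
  refine ⟨(Units.mk0 x hx)⁻¹, ?_, ?_⟩
  · simp [hx1]
  · simpa using inv_lt_one_of_one_lt₀ hx2

/-- If `v` takes a value other than `1` on the units of `w`, then not all these units lie in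
`U_v Kˣ²`: otherwise the image of the units of `w` in the value group of `v` would be
2-divisible. -/
theorem Valuation.exists_unit_notMem_unitsMulSquares
    (hfg : (MonoidWithZeroHom.valueGroup (.ofClass v : K →*₀ Γ₀)).FG)
    {u : Kˣ} (hu : w u = 1) (hu' : v u < 1) : ∃ x : Kˣ, w x = 1 ∧ x ∉ unitsMulSquares v := by
  by_contra! hn
  let φ : Kˣ →* Γ₀ˣ := Units.map (v : K →* Γ₀)
  let D : Subgroup Γ₀ˣ := (Units.map (w : K →* Γ₁)).ker.map φ
  have memD : ∀ d, d ∈ D ↔ ∃ x : Kˣ, w x = 1 ∧ φ x = d := by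
    intro d
    simp only [D, Subgroup.mem_map, MonoidHom.mem_ker, Units.ext_iff]
    rfl
  have hφ : ∀ x, ((φ x : Γ₀ˣ) : Γ₀) = v x := fun _ => rfl
  have key : φ u = 1 := by
    refine Subgroup.eq_one_of_mem_of_two_divisible hfg (D := D) ?_ ?_ ((memD _).2 ⟨u, hu, rfl⟩)
    · intro d hd
      obtain ⟨x, -, rfl⟩ := (memD _).1 hd
      exact MonoidWithZeroHom.mem_valueGroup _ ⟨x, rfl⟩
    · intro d hd
      obtain ⟨x, hx, rfl⟩ := (memD _).1 hd
      obtain ⟨a, c, ha, hxa⟩ := (mem_unitsMulSquares v x).1 (hn x hx)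
      have hxc : v x = v c ^ 2 := by rw [hxa]; simp [ha]
      suffices h : ∃ y : Kˣ, w y = 1 ∧ v y = v c by
        obtain ⟨y, hy, hyc⟩ := h
        refine ⟨φ y, (memD _).2 ⟨y, hy, rfl⟩, ?_⟩
        ext
        rw [Units.val_pow_eq_pow_val, hφ, hφ, hyc, hxc]
      have hc0 : 0 < v c := (Valuation.pos_iff v).2 c.ne_zero
      rcases lt_trichotomy (v c) 1 with h | h | h
      · refine v.exists_unit_of_lt w hx ?_ h
        rw [hxc, sq]
        exact mul_lt_of_lt_one_left hc0 h
      · exact ⟨1, by simp, by simp [h]⟩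
      · obtain ⟨y, hy, hyc⟩ := v.exists_unit_of_lt w (u := x⁻¹) (z := c⁻¹) (by simp [hx]) (by
          simp only [Units.val_inv_eq_inv_val, map_inv₀, hxc]
          refine inv_strictAnti₀ hc0 ?_
          rw [sq]
          exact lt_mul_of_one_lt_left hc0 h) (by
          simpa using inv_lt_one_of_one_lt₀ h)
        exact ⟨y⁻¹, by simp [hy], by simp [hyc]⟩
  exact hu'.ne (by rw [← hφ, key, Units.val_one])

/-- Up to inversion, a unit of `v` outside `(1 + M_v) Kˣ²` can be moved within its coset of
`1 + M_v` to a unit of `w`. -/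
theorem Valuation.exists_unit_notMem_principalUnitsMulSquares {u : Kˣ} (hu : w u = 1)
    (hu' : v u < 1) (hne : ¬ unitsMulSquares v ≤ principalUnitsMulSquares v) :
    ∃ y : Kˣ, w y = 1 ∧ v y = 1 ∧ y ∉ principalUnitsMulSquares v := by
  obtain ⟨a, ha, haT⟩ : ∃ a : Kˣ, v a = 1 ∧ a ∉ principalUnitsMulSquares v := by
    by_contra! hn
    refine hne fun x hx => ?_
    obtain ⟨a, c, ha, rfl⟩ := (mem_unitsMulSquares v x).1 hx
    refine Subgroup.mul_mem _ (hn a ha) ?_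
    exact (mem_principalUnitsMulSquares v _).2 ⟨1, c, by simp, by simp⟩
  have key : ∀ a : Kˣ, v a = 1 → a ∉ principalUnitsMulSquares v → w a < 1 →
      ∃ y : Kˣ, w y = 1 ∧ v y = 1 ∧ y ∉ principalUnitsMulSquares v := by
    intro a ha haT hwa
    have h1 : w (a + u : K) = 1 := by
      rw [w.map_add_eq_of_lt_right (by rwa [hu]), hu]
    have h0 : (a + u : K) ≠ 0 := fun h => by simp [h] at h1
    refine ⟨Units.mk0 _ h0, h1, ?_, fun h => haT ?_⟩
    · rw [Units.val_mk0, v.map_add_eq_of_lt_left (by rwa [ha]), ha]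
    · -- `a + u = a (1 + u / a)` with `u / a` in the maximal ideal of `v`
      have h2 : a⁻¹ * Units.mk0 _ h0 ∈ principalUnitsMulSquares v := by
        refine (mem_principalUnitsMulSquares v _).2 ⟨a⁻¹ * Units.mk0 _ h0, 1, ?_, by simp⟩
        have : ((a⁻¹ * Units.mk0 _ h0 : Kˣ) : K) - 1 = (a : K)⁻¹ * u := by
          push_cast; rw [Units.val_mk0]; field_simp; ring
        rw [this]
        simpa [ha] using hu'
      have h3 := Subgroup.mul_mem _ h (Subgroup.inv_mem _ h2)
      simpa using h3
  rcases lt_trichotomy (w a) 1 with h | h | h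
  · exact key a ha haT h
  · exact ⟨a, h, ha, haT⟩
  · refine key a⁻¹ (by simp [ha]) (fun h' => haT (by simpa using h')) ?_
    simpa using inv_lt_one_of_one_lt₀ h

end Comparison

/-! ### Transport of subgroups along an isomorphism of quadratic hyperfields -/

section Transport

variable {K : Type u₁} [Field K] {L : Type u₂} [Field L]

/-- The class of a unit in the quadratic hyperfield. -/
def squareClass (x : Kˣ) : QuadraticHyperfield K :=
  QuotientHyperfield.mk (Subgroup.square Kˣ) (x : K)

theorem squareClass_eq_iff {x y : Kˣ} : squareClass x = squareClass y ↔ ∃ c, x = y * (c * c) := by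
  rw [squareClass, squareClass]
  refine QuotientHyperfield.mk_eq_mk.trans ⟨?_, ?_⟩
  · rintro ⟨s, hs, t, ht, h⟩
    obtain ⟨c, rfl⟩ := Subgroup.mem_square.1 hs
    obtain ⟨d, rfl⟩ := Subgroup.mem_square.1 ht
    refine ⟨d * c⁻¹, ?_⟩
    ext
    push_cast at h ⊢
    field_simp
    linear_combination h
  · rintro ⟨c, rfl⟩
    exact ⟨1, Subgroup.one_mem _, c * c, Subgroup.mem_square.2 ⟨c, rfl⟩, by simp⟩

theorem squareClass_mul (x y : Kˣ) : squareClass (x * y) = squareClass x * squareClass y := rfl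

theorem squareClass_neg (x : Kˣ) : squareClass (-x) = -squareClass x := rfl

theorem squareClass_one : squareClass (1 : Kˣ) = 1 := rfl

theorem squareClass_ne_zero (x : Kˣ) : squareClass x ≠ 0 :=
  fun h => x.ne_zero (QuotientHyperfield.mk_eq_zero.1 h)

theorem exists_squareClass_eq {z : QuadraticHyperfield K} (hz : z ≠ 0) :
    ∃ x, squareClass x = z := by
  obtain ⟨a, rfl⟩ := QuotientHyperfield.mk_surjective z
  have ha : a ≠ 0 := fun h => hz (QuotientHyperfield.mk_eq_zero.2 h)
  exact ⟨Units.mk0 a ha, rfl⟩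

theorem mem_of_squareClass_eq {T : Subgroup Kˣ} (hT : Subgroup.square Kˣ ≤ T) {x y : Kˣ}
    (h : squareClass x = squareClass y) (hy : y ∈ T) : x ∈ T := by
  obtain ⟨c, rfl⟩ := squareClass_eq_iff.1 h
  exact T.mul_mem hy (hT (Subgroup.mem_square.2 ⟨c, rfl⟩))

theorem squareClass_mem_hadd {a b c : Kˣ} :
    squareClass c ∈ Hyperfield.hadd (squareClass a) (squareClass b) ↔
      (∃ p q r : Kˣ, (c * (p * p) : K) = a * (q * q) + b * (r * r)) ∨
        (squareClass c = squareClass a ∨ squareClass c = squareClass b ∨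
          squareClass b = squareClass (-a)) := by
  refine (Hyperfield.mem_primeAdd (H := QuotientHyperfield K (Subgroup.square Kˣ)) _ _ _).trans ?_
  refine or_congr ((QuotientHyperfield.mk_mem_add _ _ _).trans ⟨?_, ?_⟩)
    ⟨fun h => h.2.2, fun h => ⟨squareClass_ne_zero a, squareClass_ne_zero b, h⟩⟩
  · rintro ⟨s, hs, t, ht, u, hu, h⟩
    obtain ⟨p, rfl⟩ := Subgroup.mem_square.1 hs
    obtain ⟨q, rfl⟩ := Subgroup.mem_square.1 ht
    obtain ⟨r, rfl⟩ := Subgroup.mem_square.1 hu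
    exact ⟨p, q, r, by exact_mod_cast h⟩
  · rintro ⟨p, q, r, h⟩
    exact ⟨p * p, Subgroup.mem_square.2 ⟨p, rfl⟩, q * q, Subgroup.mem_square.2 ⟨q, rfl⟩, r * r,
      Subgroup.mem_square.2 ⟨r, rfl⟩, by exact_mod_cast h⟩

/-- The inverse isomorphism. -/
def Hyperfield.Iso.symm {H₁ H₂ : Type*} [Hyperfield H₁] [Hyperfield H₂] (α : Hyperfield.Iso H₁ H₂) :
    Hyperfield.Iso H₂ H₁ where
  toEquiv := α.toEquiv.symm
  isMorphism := α.isMorphism_symm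
  isMorphism_symm := α.isMorphism

variable (α : Hyperfield.Iso (QuadraticHyperfield K) (QuadraticHyperfield L))

/-- The units `x` of `K` and `y` of `L` have square classes corresponding under `α`. -/
def Corresponds (x : Kˣ) (y : Lˣ) : Prop := α.toEquiv (squareClass x) = squareClass y

variable {α}

theorem Corresponds.symm {x : Kˣ} {y : Lˣ} (h : Corresponds α x y) : Corresponds α.symm y x :=
  (Equiv.symm_apply_eq _).2 (Eq.symm h)

theorem Corresponds.mul {x x' : Kˣ} {y y' : Lˣ} (h : Corresponds α x y)
    (h' : Corresponds α x' y') : Corresponds α (x * x') (y * y') := by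
  rw [Corresponds, squareClass_mul, squareClass_mul, ← h, ← h']
  exact α.isMorphism.map_mul _ _

theorem Corresponds.neg {x : Kˣ} {y : Lˣ} (h : Corresponds α x y) : Corresponds α (-x) (-y) := by
  rw [Corresponds, squareClass_neg, squareClass_neg, ← h]
  exact α.isMorphism.map_neg _

theorem corresponds_one : Corresponds α 1 1 := by
  rw [Corresponds, squareClass_one, squareClass_one]
  exact α.isMorphism.map_one

theorem Corresponds.inv {x : Kˣ} {y : Lˣ} (h : Corresponds α x y) : Corresponds α x⁻¹ y⁻¹ := by
  have h1 : squareClass x⁻¹ = squareClass x := squareClass_eq_iff.2 ⟨x⁻¹, by group⟩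
  have h2 : squareClass y⁻¹ = squareClass y := squareClass_eq_iff.2 ⟨y⁻¹, by group⟩
  rw [Corresponds, h1, h2]
  exact h

theorem Corresponds.hadd {a b c : Kˣ} {a' b' c' : Lˣ} (ha : Corresponds α a a')
    (hb : Corresponds α b b') (hc : Corresponds α c c')
    (h : squareClass c ∈ Hyperfield.hadd (squareClass a) (squareClass b)) :
    squareClass c' ∈ Hyperfield.hadd (squareClass a') (squareClass b') := by
  rw [← ha, ← hb, ← hc]
  exact α.isMorphism.map_hadd _ _ ⟨_, h, rfl⟩

variable (α)

theorem exists_corresponds (x : Kˣ) : ∃ y : Lˣ, Corresponds α x y := by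
  have h0 : α.toEquiv (squareClass x) ≠ 0 := by
    intro h
    have h1 : α.toEquiv 0 = 0 := α.isMorphism.map_zero
    exact squareClass_ne_zero x (α.toEquiv.injective (h.trans h1.symm))
  obtain ⟨y, hy⟩ := exists_squareClass_eq h0
  exact ⟨y, hy.symm⟩

theorem exists_corresponds_right (y : Lˣ) : ∃ x : Kˣ, Corresponds α x y := by
  obtain ⟨x, hx⟩ := exists_corresponds α.symm y
  exact ⟨x, hx.symm⟩

/-- The subgroup `S` of `Lˣ` containing the squares and such that `α` maps `T Kˣ² / Kˣ²` onto
`S / Lˣ²`. -/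
def transport (T : Subgroup Kˣ) : Subgroup Lˣ where
  carrier := {y | ∃ x ∈ T, Corresponds α x y}
  one_mem' := ⟨1, T.one_mem, corresponds_one⟩
  mul_mem' := by
    rintro y y' ⟨x, hx, h⟩ ⟨x', hx', h'⟩
    exact ⟨x * x', T.mul_mem hx hx', h.mul h'⟩
  inv_mem' := by
    rintro y ⟨x, hx, h⟩
    exact ⟨x⁻¹, T.inv_mem hx, h.inv⟩

theorem transport_mono {T T' : Subgroup Kˣ} (h : T ≤ T') : transport α T ≤ transport α T' :=
  fun _ ⟨x, hx, hxy⟩ => ⟨x, h hx, hxy⟩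

theorem square_le_transport (T : Subgroup Kˣ) : Subgroup.square Lˣ ≤ transport α T := by
  intro y hy
  obtain ⟨c, rfl⟩ := Subgroup.mem_square.1 hy
  refine ⟨1, T.one_mem, ?_⟩
  have h1 : squareClass (c * c) = squareClass 1 := squareClass_eq_iff.2 ⟨c, by simp⟩
  rw [Corresponds, h1]
  exact corresponds_one

theorem image_squareClasses (T : Subgroup Kˣ) :
    α.toEquiv '' squareClasses T = squareClasses (transport α T) := by
  ext z
  constructor
  · rintro ⟨_, ⟨x, hx, rfl⟩, rfl⟩
    obtain ⟨y, hy⟩ := exists_corresponds α x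
    exact ⟨y, ⟨x, hx, hy⟩, Eq.symm hy⟩
  · rintro ⟨y, ⟨x, hx, hxy⟩, rfl⟩
    exact ⟨_, ⟨x, hx, rfl⟩, hxy⟩

variable {α} {T : Subgroup Kˣ}

theorem Corresponds.mem_transport_iff (hT : Subgroup.square Kˣ ≤ T) {x : Kˣ} {y : Lˣ}
    (h : Corresponds α x y) : y ∈ transport α T ↔ x ∈ T := by
  refine ⟨?_, fun hx => ⟨x, hx, h⟩⟩
  rintro ⟨x', hx', h'⟩
  exact mem_of_squareClass_eq hT (α.toEquiv.injective (Eq.trans h (Eq.symm h'))) hx'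

theorem transport_symm_transport (hT : Subgroup.square Kˣ ≤ T) :
    transport α.symm (transport α T) = T := by
  ext x
  obtain ⟨y, hy⟩ := exists_corresponds α x
  rw [hy.symm.mem_transport_iff (square_le_transport α T), hy.mem_transport_iff hT]

/-- The prime addition differs from the addition of `K /ₘ Kˣ²` at `a` and `b ≠ -a` only by the
elements `a` and `b` themselves, so it detects rigidity of the elements outside `-T`. -/
theorem Corresponds.isRigid (hT : Subgroup.square Kˣ ≤ T) {x : Kˣ} {y : Lˣ}
    (h : Corresponds α x y) (hx : -x ∉ T) (hr : IsRigid T x) : IsRigid (transport α T) y := by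
  intro s hs t ht
  obtain ⟨s₀, hs₀, hss⟩ := hs
  obtain ⟨t₀, ht₀, htt⟩ := ht
  have he0 : (s + t * y : L) ≠ 0 := by
    intro h0
    apply hx
    rw [← h.neg.mem_transport_iff hT]
    have : -y = t⁻¹ * s := by
      ext; push_cast; field_simp; linear_combination -h0
    rw [this]
    exact Subgroup.mul_mem _ (Subgroup.inv_mem _ ⟨t₀, ht₀, htt⟩) ⟨s₀, hs₀, hss⟩
  obtain ⟨e, he⟩ : ∃ e : Lˣ, (e : L) = s + t * y := ⟨Units.mk0 _ he0, rfl⟩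
  obtain ⟨e₀, hee⟩ := exists_corresponds_right α e
  have h1 : squareClass e ∈ Hyperfield.hadd (squareClass s) (squareClass (t * y)) :=
    squareClass_mem_hadd.2 (.inl ⟨1, 1, 1, by simp [he]⟩)
  have h2 := hss.symm.hadd (htt.mul h).symm hee.symm h1
  have h3 : e₀ ∈ T ∨ e₀ * x⁻¹ ∈ T := by
    rcases squareClass_mem_hadd.1 h2 with ⟨p, q, r, h4⟩ | h4 | h4 | h4
    · have hsq : ∀ c : Kˣ, c * c ∈ T := fun c => hT (Subgroup.mem_square.2 ⟨c, rfl⟩)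
      obtain ⟨m, hm, h5⟩ := hr (s₀ * (q * q)) (T.mul_mem hs₀ (hsq q)) (t₀ * (r * r))
        (T.mul_mem ht₀ (hsq r))
      have h6 : ((s₀ * (q * q) : Kˣ) + (t₀ * (r * r) : Kˣ) * x : K) = (e₀ * (p * p) : Kˣ) := by
        push_cast at h4 ⊢; rw [h4]; ring
      rw [h6] at h5
      rcases h5 with h5 | h5
      · left
        have h7 : e₀ * (p * p) = m := Units.ext h5
        exact (T.mul_mem_cancel_right (hsq p)).1 (h7 ▸ hm)
      · right
        have h7 : e₀ * (p * p) = m * x := Units.ext h5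
        refine (T.mul_mem_cancel_right (hsq p)).1 ?_
        rw [mul_right_comm, h7, mul_inv_cancel_right]
        exact hm
    · exact .inl (mem_of_squareClass_eq hT h4 hs₀)
    · right
      obtain ⟨c, rfl⟩ := squareClass_eq_iff.1 h4
      rw [mul_right_comm, mul_inv_cancel_right]
      exact T.mul_mem ht₀ (hT (Subgroup.mem_square.2 ⟨c, rfl⟩))
    · refine absurd ?_ hx
      obtain ⟨c, hc⟩ := squareClass_eq_iff.1 h4
      have : -x = t₀⁻¹ * (s₀ * (c * c)) := by
        rw [eq_inv_mul_iff_mul_eq, mul_neg, hc, neg_mul, neg_neg]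
      rw [this]
      exact T.mul_mem (T.inv_mem ht₀) (T.mul_mem hs₀ (hT (Subgroup.mem_square.2 ⟨c, rfl⟩)))
  rcases h3 with h3 | h3
  · exact ⟨e, (hee.mem_transport_iff hT).2 h3, .inl he.symm⟩
  · refine ⟨e * y⁻¹, ((hee.mul h.inv).mem_transport_iff hT).2 h3, .inr ?_⟩
    rw [← he]; push_cast; field_simp

theorem Corresponds.mem_basicPart (hT : Subgroup.square Kˣ ≤ T) {x : Kˣ} {y : Lˣ}
    (h : Corresponds α x y) (hy : y ∈ basicPart (transport α T)) : x ∈ basicPart T := by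
  by_cases h1 : x ∈ T
  · exact mem_basicPart_of_mem h1
  by_cases h2 : -x ∈ T
  · exact neg_mem_basicPart_iff.1 (mem_basicPart_of_mem h2)
  by_contra h3
  simp only [basicPart, Set.mem_ofPred_eq, not_or, not_not] at h3
  exact hy.elim (fun h4 => h4 (h.isRigid hT h2 h3.1))
    (fun h4 => h4 (h.neg.isRigid hT (by rwa [neg_neg]) h3.2))

theorem Corresponds.mem_basicPart_transport (hT : Subgroup.square Kˣ ≤ T) {x : Kˣ} {y : Lˣ}
    (h : Corresponds α x y) (hx : x ∈ basicPart T) : y ∈ basicPart (transport α T) := by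
  rw [← transport_symm_transport (α := α) hT] at hx
  exact h.symm.mem_basicPart (square_le_transport α T) hx

theorem basicPart_transport_subset (hT : Subgroup.square Kˣ ≤ T) {H : Subgroup Kˣ}
    (hB : basicPart T ⊆ H) : basicPart (transport α T) ⊆ transport α H := by
  intro y hy
  obtain ⟨x, hx⟩ := exists_corresponds_right α y
  exact ⟨x, hB (hx.mem_basicPart hT hy), hx⟩

theorem IsTotallyRigid.transport (hT : Subgroup.square Kˣ ≤ T) (h : IsTotallyRigid T) :
    IsTotallyRigid (transport α T) := by
  intro y hy
  obtain ⟨x, hx⟩ := exists_corresponds_right α y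
  have hx' : -x ∉ T := fun h' => hy ((hx.neg.mem_transport_iff hT).2 h')
  exact hx.isRigid hT hx' (h x hx')

theorem lift_mk_quotient_le_transport (hT : Subgroup.square Kˣ ≤ T) :
    Cardinal.lift.{u₂} #(Kˣ ⧸ T) ≤ Cardinal.lift.{u₁} #(Lˣ ⧸ transport α T) := by
  choose f hf using exists_corresponds α
  refine Cardinal.lift_mk_le_lift_mk_of_injective
    (f := fun q : Kˣ ⧸ T => (QuotientGroup.mk (f q.out) : Lˣ ⧸ transport α T)) ?_
  intro q q' h
  have h1 := QuotientGroup.eq.1 h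
  rw [((hf q.out).inv.mul (hf q'.out)).mem_transport_iff hT] at h1
  have h2 := QuotientGroup.eq.2 h1
  simpa using h2

end Transport

/-! ### The subgroups attached to a valuation -/

section ValuationSubgroups

variable {K Γ₀ : Type*} [Field K] [LinearOrderedCommGroupWithZero Γ₀] (v : Valuation K Γ₀)

theorem square_le_principalUnitsMulSquares : Subgroup.square Kˣ ≤ principalUnitsMulSquares v :=
  le_sup_right

theorem principalUnitsMulSquares_le : principalUnitsMulSquares v ≤ unitsMulSquares v :=
  sup_le_sup_right (ValuationSubring.principal_units_le_units _) _

theorem mem_unitsMulSquares_of_eq_one {x : Kˣ} (hx : v x = 1) : x ∈ unitsMulSquares v :=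
  (mem_unitsMulSquares v x).2 ⟨x, 1, hx, by simp⟩

theorem exists_add_eq_mul_of_lt {s t : Kˣ} (h : v s < v t) :
    ∃ r ∈ principalUnitsMulSquares v, (s + t : K) = r * t := by
  have hlt : v (s / t : K) < 1 := by
    rw [map_div₀]
    exact (div_lt_one₀ ((Valuation.pos_iff v).2 t.ne_zero)).2 h
  have h0 : (1 + s / t : K) ≠ 0 := by
    intro h0
    have := v.map_one_add_of_lt hlt
    simp [h0] at this
  refine ⟨Units.mk0 _ h0, (mem_principalUnitsMulSquares v _).2 ⟨_, 1, ?_, by simp; rfl⟩, ?_⟩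
  · simpa using hlt
  · rw [Units.val_mk0]; field_simp; ring

/-- If `v x ∉ 2 Γ_v`, then in a sum `s + t x` the two terms have different values and the larger
one determines the sum up to a factor in `1 + M_v`. -/
theorem basicPart_principalUnitsMulSquares_subset :
    basicPart (principalUnitsMulSquares v) ⊆ unitsMulSquares v := by
  have key : ∀ x ∉ unitsMulSquares v, IsRigid (principalUnitsMulSquares v) x := by
    intro x hx s hs t ht
    rcases lt_trichotomy (v s) (v (t * x : Kˣ)) with h | h | h
    · obtain ⟨r, hr, h1⟩ := exists_add_eq_mul_of_lt v h
      refine ⟨r * t, Subgroup.mul_mem _ hr ht, .inr ?_⟩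
      push_cast at h1 ⊢
      rw [h1]; ring
    · refine absurd ?_ hx
      have h1 : s⁻¹ * (t * x) ∈ unitsMulSquares v := by
        refine mem_unitsMulSquares_of_eq_one v ?_
        rw [Units.val_mul, map_mul, ← h, ← map_mul, ← Units.val_mul]
        simp
      rwa [← mul_assoc, Subgroup.mul_mem_cancel_left] at h1
      exact principalUnitsMulSquares_le v (Subgroup.mul_mem _ (Subgroup.inv_mem _ hs) ht)
    · obtain ⟨r, hr, h1⟩ := exists_add_eq_mul_of_lt v h
      refine ⟨r * s, Subgroup.mul_mem _ hr hs, .inl ?_⟩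
      push_cast at h1 ⊢
      rw [← h1]; ring
  have hneg : (-1 : Kˣ) ∈ unitsMulSquares v := mem_unitsMulSquares_of_eq_one v (by simp)
  rintro x (hx | hx) <;> by_contra h
  · exact hx (key x h)
  · refine hx (key (-x) fun h' => h ?_)
    simpa using Subgroup.mul_mem _ hneg h'

/-- The hypotheses on `w` exclude units of `w` in `M_v`, so `w` is finer than `v`. -/
theorem principalUnitsMulSquares_le_of_unitGroup_le
    (hfg : (MonoidWithZeroHom.valueGroup (.ofClass v : K →*₀ Γ₀)).FG) (w : ValuationSubring K)
    {G : Subgroup Kˣ} (hw : w.unitGroup ≤ G)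
    (hG : G ≤ unitsMulSquares v ∨ (¬ unitsMulSquares v ≤ principalUnitsMulSquares v ∧
      ∀ x ∈ G, ∀ y ∈ G, x ∉ principalUnitsMulSquares v → y ∉ principalUnitsMulSquares v →
        x * y ∈ principalUnitsMulSquares v)) :
    principalUnitsMulSquares v ≤ w.principalUnitGroup ⊔ Subgroup.square Kˣ := by
  refine sup_le_sup_right (ValuationSubring.principalUnitGroup_le_principalUnitGroup.2 ?_) _
  intro y hy
  by_contra hyv
  rw [Valuation.mem_valuationSubring_iff, not_le] at hyv
  obtain ⟨u, hu, huv⟩ := v.exists_unit_lt_one w.valuation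
    ((ValuationSubring.valuation_le_one_iff _ _).2 hy) hyv
  obtain ⟨x, hx, hxU⟩ := v.exists_unit_notMem_unitsMulSquares w.valuation hfg hu huv
  have hxG : x ∈ G := hw hx
  rcases hG with hG | ⟨hne, hG⟩
  · exact hxU (hG hxG)
  · obtain ⟨z, hz, hzv, hzT⟩ :=
      v.exists_unit_notMem_principalUnitsMulSquares w.valuation hu huv hne
    have hxz := hG x hxG z (hw hz) (fun h => hxU (principalUnitsMulSquares_le v h)) hzT
    exact hxU ((Subgroup.mul_mem_cancel_right _ (mem_unitsMulSquares_of_eq_one v hzv)).1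
      (principalUnitsMulSquares_le v hxz))

theorem principalUnitsMulSquares_valuation (A : ValuationSubring K) :
    principalUnitsMulSquares A.valuation = A.principalUnitGroup ⊔ Subgroup.square Kˣ := by
  rw [principalUnitsMulSquares, ValuationSubring.valuationSubring_valuation]

theorem unitsMulSquares_valuation (A : ValuationSubring K) :
    unitsMulSquares A.valuation = A.unitGroup ⊔ Subgroup.square Kˣ := by
  rw [unitsMulSquares, ValuationSubring.valuationSubring_valuation]

end ValuationSubgroups

/-! ### Cardinalities of quotients -/

section Cardinalities

variable {G : Type*} [Group G] {S T : Subgroup G}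

theorem Subgroup.mk_quotient_le_of_le (h : S ≤ T) : #(G ⧸ T) ≤ #(G ⧸ S) :=
  Cardinal.mk_le_of_surjective (f := Subgroup.quotientMapOfLE h) fun q => by
    obtain ⟨x, rfl⟩ := QuotientGroup.mk_surjective q
    exact ⟨QuotientGroup.mk x, rfl⟩

theorem Subgroup.mk_quotient_eq_mul_two (h : S ≤ T) (h2 : S.relIndex T = 2) :
    #(G ⧸ S) = 2 * #(G ⧸ T) := by
  have h3 : #(T ⧸ S.subgroupOf T) = 2 :=
    Cardinal.mk_eq_two_iff.2 (Nat.card_eq_two_iff.1 h2)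
  rw [Cardinal.mk_congr (Subgroup.quotientEquivProdOfLE h), Cardinal.mk_prod, Cardinal.lift_id,
    Cardinal.lift_id, h3, mul_comm]

theorem Subgroup.mk_quotient_le_mul_two (h : S ≤ T)
    (h2 : ∀ x ∈ T, ∀ y ∈ T, x ∉ S → y ∉ S → x * y ∈ S) : #(G ⧸ S) ≤ 2 * #(G ⧸ T) := by
  have h3 : #(T ⧸ S.subgroupOf T) ≤ 2 := by
    classical
    suffices hinj : Function.Injective
        fun q : T ⧸ S.subgroupOf T => decide (q = (QuotientGroup.mk 1 : T ⧸ S.subgroupOf T)) by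
      simpa using Cardinal.lift_mk_le_lift_mk_of_injective hinj
    intro q q' hq
    rw [decide_eq_decide] at hq
    by_cases hq1 : q = QuotientGroup.mk 1
    · rw [hq1, hq.1 hq1]
    have hq2 := mt hq.2 hq1
    obtain ⟨x, rfl⟩ := QuotientGroup.mk_surjective q
    obtain ⟨y, rfl⟩ := QuotientGroup.mk_surjective q'
    rw [eq_comm, QuotientGroup.eq, inv_one, one_mul, Subgroup.mem_subgroupOf] at hq1 hq2
    rw [QuotientGroup.eq, Subgroup.mem_subgroupOf]
    exact h2 _ (T.inv_mem x.2) _ y.2 (by simpa using hq1) hq2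
  rw [Cardinal.mk_congr (Subgroup.quotientEquivProdOfLE h), Cardinal.mk_prod, Cardinal.lift_id,
    Cardinal.lift_id, mul_comm]
  gcongr

end Cardinalities

/-! ### Transport of valuations -/

section Main

variable {K : Type u₁} [Field K] {L : Type u₂} [Field L]

/-- The reverse inclusion is built into the choice of `A`. Pulling `S₁ = (1 + M_A) Lˣ²` back to a
subgroup `T₁` of `Kˣ` and applying the existence theorem to `T₁`, one obtains a valuation of `K`
finer than `v` with `1 + M ⊆ T₁`. -/
theorem transport_le_principalUnitsMulSquares
    (α : Hyperfield.Iso (QuadraticHyperfield K) (QuadraticHyperfield L))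
    {Γ₀ : Type u₃} [LinearOrderedCommGroupWithZero Γ₀] (v : Valuation K Γ₀)
    (hfg : (MonoidWithZeroHom.valueGroup (.ofClass v : K →*₀ Γ₀)).FG)
    {A : ValuationSubring L} {H : Subgroup Lˣ} (hsq : Subgroup.square Lˣ ≤ H)
    (hAT : A.principalUnitGroup ≤ transport α (principalUnitsMulSquares v))
    (hAH : A.unitGroup ≤ H)
    (h : (¬ IsTotallyRigid (principalUnitsMulSquares v) ∧ H ≤ transport α (unitsMulSquares v)) ∨
      (-1 ∈ principalUnitsMulSquares v ∧ ¬ unitsMulSquares v ≤ principalUnitsMulSquares v ∧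
        ∀ x ∈ H, ∀ y ∈ H, x ∉ transport α (principalUnitsMulSquares v) →
          y ∉ transport α (principalUnitsMulSquares v) →
            x * y ∈ transport α (principalUnitsMulSquares v))) :
    transport α (principalUnitsMulSquares v) ≤ principalUnitsMulSquares A.valuation := by
  set T := principalUnitsMulSquares v with hT
  have hTsq : Subgroup.square Kˣ ≤ T := square_le_principalUnitsMulSquares v
  set S₁ := principalUnitsMulSquares A.valuation with hS₁
  have hS₁sq : Subgroup.square Lˣ ≤ S₁ := square_le_principalUnitsMulSquares _
  have hS₁T : S₁ ≤ transport α T := by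
    rw [hS₁, principalUnitsMulSquares_valuation]
    exact sup_le hAT (square_le_transport α T)
  have hU₁H : unitsMulSquares A.valuation ≤ H := by
    rw [unitsMulSquares_valuation]
    exact sup_le hAH hsq
  set T₁ := transport α.symm S₁ with hT₁
  have hT₁sq : Subgroup.square Kˣ ≤ T₁ := square_le_transport _ _
  have hT₁T : T₁ ≤ T := by
    have := transport_mono α.symm hS₁T
    rwa [transport_symm_transport hTsq] at this
  suffices hTT₁ : T ≤ T₁ by
    have h1 := transport_mono α hTT₁
    have h2 : transport α T₁ = S₁ := transport_symm_transport (α := α.symm) hS₁sq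
    rwa [h2] at h1
  have hB₁ : basicPart T₁ ⊆ transport α.symm (unitsMulSquares A.valuation) :=
    basicPart_transport_subset hS₁sq (basicPart_principalUnitsMulSquares_subset _)
  suffices hex : ∃ (G : Subgroup Kˣ) (w : ValuationSubring K), w.unitGroup ≤ G ∧
      w.principalUnitGroup ≤ T₁ ∧ (G ≤ unitsMulSquares v ∨ (¬ unitsMulSquares v ≤ T ∧
        ∀ x ∈ G, ∀ y ∈ G, x ∉ T → y ∉ T → x * y ∈ T)) by
    obtain ⟨G, w, hw1, hw2, hG⟩ := hex
    exact (principalUnitsMulSquares_le_of_unitGroup_le v hfg w hw1 hG).trans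
      (sup_le hw2 hT₁sq)
  by_cases hrig : IsTotallyRigid T₁
  · obtain ⟨hneg, hne, -⟩ := h.resolve_left fun h' => h'.1 (hrig.mono hT₁T)
    have hB : basicPart T₁ ⊆ T := by
      rw [(isExceptional_iff_isTotallyRigid.2 hrig).1]
      rintro x (hx | hx)
      · exact hT₁T hx
      · have := T.mul_mem hneg (hT₁T hx)
        rwa [neg_one_mul, neg_neg] at this
    obtain ⟨G, -, hG, w, hw1, hw2⟩ :=
      (RigidOutside.of_basicPart_subset hT₁sq hB).exists_valuationSubring
    exact ⟨G, w, hw1, hw2, .inr ⟨hne, hG⟩⟩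
  · obtain ⟨w, hw1, hw2⟩ := exists_valuationSubring_of_not_isTotallyRigid hT₁sq hB₁ hrig
    refine ⟨_, w, hw1, hw2, ?_⟩
    rcases h with ⟨-, hH⟩ | ⟨-, hne, hH⟩
    · left
      have := transport_mono α.symm (hU₁H.trans hH)
      rwa [transport_symm_transport
        (hTsq.trans (principalUnitsMulSquares_le v))] at this
    · refine .inr ⟨hne, ?_⟩
      rintro x ⟨x', hx', hxx⟩ y ⟨y', hy', hyy⟩ hx hy
      have hxx' : Corresponds α x x' := hxx.symm
      have hyy' : Corresponds α y y' := hyy.symm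
      rw [← (hxx'.mul hyy').mem_transport_iff hTsq]
      exact hH _ (hU₁H hx') _ (hU₁H hy') (fun h' => hx ((hxx'.mem_transport_iff hTsq).1 h'))
        (fun h' => hy ((hyy'.mem_transport_iff hTsq).1 h'))

end Main

theorem mainTheorem3 {K : Type u₁} [Field K] {L : Type u₂} [Field L]
    (α : Hyperfield.Iso (QuadraticHyperfield K) (QuadraticHyperfield L))
    {Γ₀ : Type u₃} [LinearOrderedCommGroupWithZero Γ₀] (v : Valuation K Γ₀)
    (hfg : (MonoidWithZeroHom.valueGroup (.ofClass v : K →*₀ Γ₀)).FG)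
    (h : (basicPart (principalUnitsMulSquares v) = (unitsMulSquares v : Set Kˣ) ∧
            ¬ IsExceptional (principalUnitsMulSquares v)) ∨
         (basicPart (principalUnitsMulSquares v) = (principalUnitsMulSquares v : Set Kˣ) ∧
            (principalUnitsMulSquares v).relIndex (unitsMulSquares v) = 2)) :
    ∃ (Γ₁ : Type u₂) (_ : LinearOrderedCommGroupWithZero Γ₁) (w : Valuation L Γ₁),
      α.toEquiv '' squareClasses (principalUnitsMulSquares v) =
          squareClasses (principalUnitsMulSquares w) ∧
      Cardinal.lift.{u₂} #(Kˣ ⧸ unitsMulSquares v) ≤ Cardinal.lift.{u₁} #(Lˣ ⧸ unitsMulSquares w) ∧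
      ((basicPart (principalUnitsMulSquares v) = (unitsMulSquares v : Set Kˣ) ∧
            ¬ IsExceptional (principalUnitsMulSquares v)) →
        α.toEquiv '' squareClasses (unitsMulSquares v) = squareClasses (unitsMulSquares w)) := by
  have hTsq := square_le_principalUnitsMulSquares v
  have hTU := principalUnitsMulSquares_le v
  have hUsq := hTsq.trans hTU
  have hSsq := square_le_transport α (principalUnitsMulSquares v)
  rcases h with ⟨hB, hexc⟩ | ⟨hB, hind⟩
  · rw [isExceptional_iff_isTotallyRigid] at hexc
    have hexcS : ¬ IsTotallyRigid (transport α (principalUnitsMulSquares v)) := fun h' => hexc (by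
      rw [← transport_symm_transport (α := α) hTsq]
      exact h'.transport hSsq)
    obtain ⟨A, hA1, hA2⟩ := exists_valuationSubring_of_not_isTotallyRigid hSsq
      (basicPart_transport_subset hTsq hB.subset) hexcS
    have hle := transport_le_principalUnitsMulSquares α v hfg (square_le_transport α _) hA2 hA1
      (.inl ⟨hexc, le_rfl⟩)
    have hT : transport α (principalUnitsMulSquares v) = principalUnitsMulSquares A.valuation := by
      refine le_antisymm hle ?_
      rw [principalUnitsMulSquares_valuation]
      exact sup_le hA2 hSsq
    have hU : transport α (unitsMulSquares v) = unitsMulSquares A.valuation := by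
      refine le_antisymm ?_ ?_
      · rintro y ⟨x, hx, hxy⟩
        refine basicPart_principalUnitsMulSquares_subset A.valuation ?_
        rw [← hT]
        exact hxy.mem_basicPart_transport hTsq (hB.superset hx)
      · rw [unitsMulSquares_valuation]
        exact sup_le hA1 (square_le_transport α _)
    refine ⟨A.ValueGroup, inferInstance, A.valuation, ?_, ?_, fun _ => ?_⟩
    · rw [image_squareClasses, hT]
    · rw [← hU]
      exact lift_mk_quotient_le_transport hUsq
    · rw [image_squareClasses, hU]
  · have hne : ¬ unitsMulSquares v ≤ principalUnitsMulSquares v := fun h' => by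
      rw [Subgroup.relIndex_eq_one.2 h'] at hind
      omega
    have hneg : -1 ∈ principalUnitsMulSquares v :=
      hB.subset (Or.inl (not_isRigid_of_neg_mem (by simp)))
    obtain ⟨H, hSH, hH, A, hA1, hA2⟩ := (RigidOutside.of_basicPart_subset hSsq
      (basicPart_transport_subset hTsq hB.subset)).exists_valuationSubring
    have hle := transport_le_principalUnitsMulSquares α v hfg (hSsq.trans hSH) hA2 hA1
      (.inr ⟨hneg, hne, hH⟩)
    have hT : transport α (principalUnitsMulSquares v) = principalUnitsMulSquares A.valuation := by
      refine le_antisymm hle ?_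
      rw [principalUnitsMulSquares_valuation]
      exact sup_le hA2 hSsq
    have hUH : unitsMulSquares A.valuation ≤ H := by
      rw [unitsMulSquares_valuation]
      exact sup_le hA1 (hSsq.trans hSH)
    refine ⟨A.ValueGroup, inferInstance, A.valuation, ?_, ?_, fun h' => ?_⟩
    · rw [image_squareClasses, hT]
    · -- `2 (Kˣ : U_v Kˣ²) = (Kˣ : T) = (Lˣ : S) ≤ 2 (Lˣ : H)`
      have h1 := lift_mk_quotient_le_transport (α := α) hTsq
      have h2 := Cardinal.lift_le.{u₁}.2 (Subgroup.mk_quotient_le_mul_two hSH hH)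
      rw [Subgroup.mk_quotient_eq_mul_two hTU hind] at h1
      have h3 := h1.trans h2
      rw [Cardinal.lift_mul, Cardinal.lift_mul, Cardinal.lift_ofNat, Cardinal.lift_ofNat] at h3
      have h4 := (Cardinal.natCast_mul_le_natCast_mul (n := 2) two_ne_zero).1 (by exact_mod_cast h3)
      exact h4.trans (Cardinal.lift_le.2 (Subgroup.mk_quotient_le_of_le hUH))
    · refine absurd ?_ hne
      intro x hx
      exact hB.subset (h'.1.superset hx)
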